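/- Let $d\in\{1,2\}$, $q\in\mathbb N$, $\Omega_0=\{1,\dots,q\}$ and $\Omega=\Omega_0^{\mathbb Z^d}$ with the product topology and its Borel $\sigma$-algebra; $\mathcal M_1(\Omega)$ is the set of probability measures on $\Omega$. For $f:\Omega\to\mathbb R$ and $y\in\mathbb Z^d$ let $\delta_y(f)=\sup\{|f(\eta)-f(\xi)|:\eta_z=\xi_z\text{ for all }z\ne y\}$, and let $\eta^{x,i}$ be the configuration equal to $i$ at $x$ and to $\eta$ elsewhere. Let $c_x(\eta,i)$ ($x\in\mathbb Z^d$, $\eta\in\Omega$, $i\in\Omega_0$) be transition rates such that (R1) $\sup_x\sum_i\|c_x(\cdot,i)\|_\infty<\infty$; (R2) $\eta\mapsto c_x(\eta,i)\in[0,\infty)$ is continuous for all $x,i$; (R3) $\inf_{x,\eta,i}c_x(\eta,i)>0$; (R4) $\sum_{y\in\mathbb Z^d}|y|\,\sup_{x\in\mathbb Z^d}\sum_{i}\delta_{x+y}\big(\hat c_x(\cdot,i)\big)<\infty$, where $\hat c_x(\eta,i)=c_x(\eta,i)$ if $\eta_x\ne i$ and $\hat c_x(\eta,i)=0$ if $\eta_x=i$.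 Let $(P_t)_{t\ge0}$ be the Markov semigroup on $C(\Omega)$ whose generator is the closure of $$\mathscr Lf(\eta)=\sum_{x\in\mathbb Z^d}\sum_{i\in\Omega_0}c_x(\eta,i)\,[f(\eta^{x,i})-f(\eta)]$$ on $D(\Omega)=\{f\in C(\Omega):\sum_x\delta_x(f)<\infty\}$, and for $\nu\in\mathcal M_1(\Omega)$ let $\nu P_t$ be the law at time $t$ of the process started from $\nu$. Suppose that some product measure $\mu=\bigotimes_{x\in\mathbb Z^d}\rho_x$ (with marginals that may depend on the site) is time-stationary, i.e. $\mu P_t=\mu$ for all $t\ge0$. Then the measure-valued dynamics $(t,\nu)\mapsto\nu P_t$ has no non-trivial time-periodic orbit: there is no $\nu\in\mathcal M_1(\Omega)$ such that $(\nu P_t)_{t\ge0}$ is non-constant and such that, for some $T>0$, $\nu P_{t+T}=\nu P_t$ for all $t\ge0$. -/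

import Mathlib

open MeasureTheory ProbabilityTheory Filter Topology
open scoped ENNReal NNReal

noncomputable section

namespace IPS

/-! ### Markov (Feller) semigroups on a compact space -/

/-- A Markov semigroup on `C(X)`, given by its transition kernels: a Feller semigroup of Markov
kernels which is strongly continuous on `C(X)`. -/
structure MarkovSemigroup (X : Type*) [TopologicalSpace X] [MeasurableSpace X] where
  /-- the transition kernels `P_t(η, dζ)` -/
  kernel : ℝ≥0 → Kernel X X
  isMarkov : ∀ t, IsMarkovKernel (kernel t)
  kernel_zero : kernel 0 = Kernel.id
  kernel_add : ∀ s t, kernel (s + t) = kernel t ∘ₖ kernel s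
  /-- `P_t` maps `C(X)` into `C(X)` -/
  feller : ∀ t (f : C(X, ℝ)), Continuous fun η => ∫ ζ, f ζ ∂(kernel t η)
  /-- `P_t f → f` uniformly as `t ↓ 0` -/
  strongly_continuous : ∀ f : C(X, ℝ),
    TendstoUniformly (fun t η => ∫ ζ, f ζ ∂(kernel t η)) f (𝓝 0)

namespace MarkovSemigroup

variable {X : Type*} [TopologicalSpace X] [MeasurableSpace X]

/-- The operator `P_t` on continuous functions. -/
def op (P : MarkovSemigroup X) (t : ℝ≥0) (f : C(X, ℝ)) : C(X, ℝ) :=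
  ⟨fun η => ∫ ζ, f ζ ∂(P.kernel t η), P.feller t f⟩

/-- The time-evolved measure `ν P_t`. -/
def evolve (P : MarkovSemigroup X) (ν : ProbabilityMeasure X) (t : ℝ≥0) : ProbabilityMeasure X :=
  ⟨(ν : Measure X).bind (P.kernel t), by
    have := P.isMarkov t
    infer_instance⟩

/-- The graph of the infinitesimal generator of the semigroup: all `(f, g)` such that
`(P_t f - f) / t → g` in `C(X)` as `t ↓ 0`. -/
def generatorGraph (P : MarkovSemigroup X) : Set (C(X, ℝ) × C(X, ℝ)) :=
  {p | Tendsto (fun t : ℝ≥0 => (t : ℝ)⁻¹ • (P.op t p.1 - p.1)) (𝓝[>] 0) (𝓝 p.2)}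

/-- `μ` is time-stationary: `μ P_t = μ` for all `t ≥ 0`. -/
def IsStationary (P : MarkovSemigroup X) (μ : ProbabilityMeasure X) : Prop :=
  ∀ t, P.evolve μ t = μ

end MarkovSemigroup

/-! ### Configurations and transition rates -/

/-- Configurations on `ℤ^d` with local state space of size `q`, with the product topology and the
product (= Borel) sigma-algebra. -/
abbrev Config (d q : ℕ) : Type := (Fin d → ℤ) → Fin q

/-- Single-site transition rates: `c x i η` is the rate at which the spin at site `x` switches to
the state `i` when the system is in configuration `η`. -/
abbrev Rates (d q : ℕ) : Type := (Fin d → ℤ) → Fin q → Config d q → ℝ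

variable {d q : ℕ}

/-- The oscillation `δ_y(f)` of `f` at the site `y`. -/
def osc (y : Fin d → ℤ) (f : Config d q → ℝ) : ℝ≥0∞ :=
  ⨆ (η : Config d q) (ξ : Config d q) (_ : ∀ z, z ≠ y → η z = ξ z), edist (f η) (f ξ)

/-- The rate of actual jumps to the state `i` at the site `x`: it is `c x i η` if `η x ≠ i`, and
`0` if the spin at `x` is already `i`. Summed over `i` this is the total rate at which the spin at
`x` changes. -/
def jumpRate (c : Rates d q) (x : Fin d → ℤ) (i : Fin q) (η : Config d q) : ℝ :=
  if η x = i then 0 else c x i η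

/-- The standing conditions on the transition rates. -/
structure Rates.Regular (c : Rates d q) : Prop where
  /-- `sup_x ∑_i ‖c_x(·, i)‖_∞ < ∞` -/
  bounded : ⨆ x, ∑ i, ⨆ η, ‖c x i η‖ₑ < ⊤
  /-- each rate is a continuous function of the configuration -/
  continuous : ∀ x i, Continuous (c x i)
  /-- the rates are bounded away from zero -/
  pos : ∃ κ : ℝ, 0 < κ ∧ ∀ x i η, κ ≤ c x i η
  /-- short range: `∑_y |y| sup_x ∑_i δ_{x+y} c_x(·, i) < ∞` -/
  shortRange : ∑' y : Fin d → ℤ, ‖y‖ₑ * ⨆ x, ∑ i, osc (x + y) (jumpRate c x i) < ⊤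

/-- The graph of `𝓛 f(η) = ∑_x ∑_i c_x(η, i) [f(η^{x,i}) - f(η)]` on the space `D(Ω)` of continuous
functions with finite total oscillation. -/
def preGeneratorGraph (c : Rates d q) : Set (C(Config d q, ℝ) × C(Config d q, ℝ)) :=
  {p | ∑' x, osc x p.1 < ⊤ ∧
    ∀ η, HasSum (fun x => ∑ i, c x i η * (p.1 (Function.update η x i) - p.1 η)) (p.2 η)}

/-- `P` is the Markov semigroup of the interacting particle system with rates `c`: its generator is
the closure in `C(Ω)` of the operator `𝓛` on `D(Ω)`. -/
def IsGeneratedBy (P : MarkovSemigroup (Config d q)) (c : Rates d q) : Prop :=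
  P.generatorGraph = closure (preGeneratorGraph c)

/-- `μ` is a product measure (the marginals may depend on the site). -/
def IsProductMeasure (μ : ProbabilityMeasure (Config d q)) : Prop :=
  ∃ ρ : (Fin d → ℤ) → ProbabilityMeasure (Fin q),
    (μ : Measure (Config d q)) = Measure.infinitePi fun x => (ρ x : Measure (Fin q))

end IPS

end

noncomputable section

namespace IPS
-- Evolution of expectations under a Feller semigroup.
namespace MarkovSemigroup

variable {X : Type*} [TopologicalSpace X] [MeasurableSpace X]

/-! The entropy of a periodic orbit relative to `μ`, restricted to a finite box, is the same after
one period, so its derivative integrates to zero. That derivative is at most a dissipation term,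
`-κ` times a Hellinger form summed over the sites of the box, plus an error due to the dependence of
the rates on spins outside the box. Stationarity of `μ` lets the corresponding expression under `μ`
be subtracted, so only the oscillation of the rates on a cylinder enters the error
(`integral_localGen_log_le`). Writing `e n x` for the Hellinger form at `x` in the `n`-th box,
integrated over a period, and `a n x` for the influence on `x` from outside that box, this becomes
`κ ∑ e ≤ C ∑ a √e` (`integral_hellinger_le`).

Since `μ` is a product, the weights in the Hellinger form at `x` involve only the marginal at `x`,
and `e n x` increases with `n` (`hellinger_mono`). The first moment condition gives `∑_x a n x =
O(n^(d-1))` and, for fixed `x`, a uniform bound on `∑_n a n x`. With `V N = ∑_{n<N} ∑_x a n x * e n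
x`, Cauchy–Schwarz and these bounds yield `V (N+1)² ≤ const * (2N+1) * (V (N+1) - V N)` when `d ≤
2`. If `V` were ever positive, the harmonic series would converge; hence `V`, and then `e`, vanish
(`eq_zero_of_sum_le_sum_mul_sqrt`). A zero Hellinger form identifies the cylinder probabilities with
those of `μ`.

The logarithms require all cylinders to have positive probability. Stationarity and the bounds on
the rates give this for `μ` (`le_mul_cyl_singleton`), and the argument is run for the equal mixture
of `ν` and `μ`, which is again periodic. -/

lemma evolve_zero (P : MarkovSemigroup X) (ν : ProbabilityMeasure X) : P.evolve ν 0 = ν := by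
  apply Subtype.ext
  simp [evolve, P.kernel_zero]

lemma evolve_add (P : MarkovSemigroup X) (ν : ProbabilityMeasure X) (s t : ℝ≥0) :
    P.evolve ν (s + t) = P.evolve (P.evolve ν s) t := by
  apply Subtype.ext
  simp only [evolve, P.kernel_add]
  exact Measure.comp_assoc.symm

variable [CompactSpace X]

lemma tendsto_op (P : MarkovSemigroup X) (f : C(X, ℝ)) :
    Tendsto (fun t => ‖P.op t f - f‖) (𝓝 0) (𝓝 0) := by
  have h : Tendsto (fun t => P.op t f) (𝓝 0) (𝓝 f) :=
    (ContinuousMap.tendsto_iff_tendstoUniformly).2 (P.strongly_continuous f)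
  exact tendsto_iff_norm_sub_tendsto_zero.1 h

variable [BorelSpace X]

lemma integrable_continuousMap (ν : Measure X) [IsFiniteMeasure ν] (f : C(X, ℝ)) :
    Integrable f ν :=
  (BoundedContinuousFunction.mkOfCompact f).integrable ν

lemma integral_evolve (P : MarkovSemigroup X) (ν : ProbabilityMeasure X) (t : ℝ≥0)
    (f : C(X, ℝ)) :
    ∫ x, f x ∂(P.evolve ν t : Measure X) = ∫ x, P.op t f x ∂(ν : Measure X) := by
  have := P.isMarkov t
  have hf : Integrable f (P.evolve ν t : Measure X) := integrable_continuousMap _ f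
  have h : (P.evolve ν t : Measure X)
      = (P.kernel t ∘ₖ Kernel.const Unit (ν : Measure X)) () := by
    simp only [evolve]
    exact Measure.comp_eq_comp_const_apply
  rw [h] at hf ⊢
  rw [Kernel.integral_comp hf]
  rfl

lemma abs_integral_sub_le (ν : ProbabilityMeasure X) (f g : C(X, ℝ)) :
    |∫ x, f x ∂(ν : Measure X) - ∫ x, g x ∂(ν : Measure X)| ≤ ‖f - g‖ := by
  rw [← integral_sub (integrable_continuousMap _ f) (integrable_continuousMap _ g)]
  have := norm_integral_le_of_norm_le_const (μ := (ν : Measure X)) (f := fun x => f x - g x)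
    (C := ‖f - g‖) (Eventually.of_forall fun x => (f - g).norm_coe_le_norm x)
  simpa using this

lemma continuous_integral (ν : ProbabilityMeasure X) :
    Continuous fun f : C(X, ℝ) => ∫ x, f x ∂(ν : Measure X) := by
  refine LipschitzWith.continuous (K := 1) (LipschitzWith.of_dist_le_mul fun f g => ?_)
  simpa [Real.dist_eq, dist_eq_norm] using abs_integral_sub_le ν f g

/-- The expectation of `f` at time `t` of the process started from `ν`, as a function of real
time. -/
def mean (P : MarkovSemigroup X) (ν : ProbabilityMeasure X) (f : C(X, ℝ)) (t : ℝ) : ℝ :=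
  ∫ x, f x ∂(P.evolve ν t.toNNReal : Measure X)

lemma abs_integral_evolve_sub_le (P : MarkovSemigroup X) (ν : ProbabilityMeasure X) (f : C(X, ℝ))
    (s t : ℝ≥0) :
    |∫ x, f x ∂(P.evolve ν (s + t) : Measure X) - ∫ x, f x ∂(P.evolve ν s : Measure X)|
      ≤ ‖P.op t f - f‖ := by
  rw [evolve_add, integral_evolve P (P.evolve ν s)]
  exact abs_integral_sub_le _ _ _

lemma continuous_integral_evolve (P : MarkovSemigroup X) (ν : ProbabilityMeasure X)
    (f : C(X, ℝ)) : Continuous fun t : ℝ≥0 => ∫ x, f x ∂(P.evolve ν t : Measure X) := by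
  refine Metric.continuous_iff.2 fun t ε hε => ?_
  obtain ⟨δ, hδ, h⟩ := Metric.tendsto_nhds_nhds.1 (P.tendsto_op f) ε hε
  have key : ∀ r : ℝ≥0, (r : ℝ) < δ → ‖P.op r f - f‖ < ε := fun r hr => by
    have := @h r (by simpa [NNReal.dist_eq] using hr)
    simpa using this
  refine ⟨δ, hδ, fun s hs => ?_⟩
  rw [NNReal.dist_eq] at hs
  rcases le_total s t with hst | hst
  · obtain ⟨r, rfl⟩ := exists_add_of_le hst
    rw [dist_comm, Real.dist_eq]
    refine (P.abs_integral_evolve_sub_le ν f s r).trans_lt (key r ?_)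
    have := (abs_lt.1 hs).1
    push_cast at this
    linarith
  · obtain ⟨r, rfl⟩ := exists_add_of_le hst
    rw [Real.dist_eq]
    refine (P.abs_integral_evolve_sub_le ν f t r).trans_lt (key r ?_)
    have := (abs_lt.1 hs).2
    push_cast at this
    linarith

lemma continuous_mean (P : MarkovSemigroup X) (ν : ProbabilityMeasure X) (f : C(X, ℝ)) :
    Continuous (P.mean ν f) :=
  (P.continuous_integral_evolve ν f).comp continuous_real_toNNReal

lemma tendsto_slope_of_mem_generatorGraph (P : MarkovSemigroup X) (ν : ProbabilityMeasure X)
    {f g : C(X, ℝ)} (h : (f, g) ∈ P.generatorGraph) (t : ℝ≥0) :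
    Tendsto (fun r : ℝ≥0 => (r : ℝ)⁻¹ * (∫ x, f x ∂(P.evolve ν (t + r) : Measure X)
      - ∫ x, f x ∂(P.evolve ν t : Measure X))) (𝓝[>] 0)
      (𝓝 (∫ x, g x ∂(P.evolve ν t : Measure X))) := by
  have h1 := ((continuous_integral (P.evolve ν t)).tendsto g).comp h
  refine h1.congr fun r => ?_
  simp only [Function.comp_apply, ContinuousMap.coe_smul, Pi.smul_apply, ContinuousMap.coe_sub,
    Pi.sub_apply, smul_eq_mul]
  rw [integral_const_mul, integral_sub (integrable_continuousMap _ _)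
    (integrable_continuousMap _ _), evolve_add, integral_evolve P (P.evolve ν t)]

/-- The generator is a limit as `t ↓ 0`, so it gives right derivatives; these suffice for the
fundamental theorem of calculus applied to the entropy. -/
lemma hasDerivWithinAt_mean (P : MarkovSemigroup X) (ν : ProbabilityMeasure X)
    {f g : C(X, ℝ)} (h : (f, g) ∈ P.generatorGraph) {t : ℝ} (ht : 0 ≤ t) :
    HasDerivWithinAt (P.mean ν f) (P.mean ν g t) (Set.Ioi t) t := by
  rw [hasDerivWithinAt_iff_tendsto_slope' (by simp)]
  have h1 := P.tendsto_slope_of_mem_generatorGraph ν h t.toNNReal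
  have h2 : Tendsto (fun s : ℝ => (s - t).toNNReal) (𝓝[>] t) (𝓝[>] 0) := by
    refine tendsto_nhdsWithin_iff.2 ⟨?_, ?_⟩
    · have : Continuous fun s : ℝ => (s - t).toNNReal := by fun_prop
      have h3 := this.tendsto t
      simp only [sub_self, Real.toNNReal_zero] at h3
      exact h3.mono_left nhdsWithin_le_nhds
    · filter_upwards [self_mem_nhdsWithin] with s hs
      simpa using hs
  refine (h1.comp h2).congr' ?_
  filter_upwards [self_mem_nhdsWithin] with s hs
  have hs' : t < s := hs
  rw [slope_def_field, Function.comp_apply, ← Real.toNNReal_add ht (by linarith),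
    Real.coe_toNNReal _ (by linarith), add_sub_cancel]
  simp only [mean]
  ring

lemma IsStationary.integral_generator_eq_zero {P : MarkovSemigroup X} {μ : ProbabilityMeasure X}
    (hμ : P.IsStationary μ) {f g : C(X, ℝ)} (h : (f, g) ∈ P.generatorGraph) :
    ∫ x, g x ∂(μ : Measure X) = 0 := by
  have h1 := P.hasDerivWithinAt_mean μ h le_rfl
  have h2 : P.mean μ f = fun _ => ∫ x, f x ∂(μ : Measure X) := by
    funext t
    rw [mean, hμ]
  have h3 : P.mean μ g 0 = ∫ x, g x ∂(μ : Measure X) := by rw [mean, hμ]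
  rw [h2, h3] at h1
  exact (uniqueDiffWithinAt_Ioi (0 : ℝ)).eq_deriv _ h1 (hasDerivWithinAt_const _ _ _)

end MarkovSemigroup

/-! ### Local functions, the generator on them, and cylinder probabilities. -/

variable {d q : ℕ}

/-- The function of the configuration that depends only on its restriction to `Λ`. -/
def localFun (Λ : Finset (Fin d → ℤ)) (G : (Λ → Fin q) → ℝ) : C(Config d q, ℝ) :=
  ⟨fun η => G (Λ.restrict η),
    (continuous_of_discreteTopology (f := G)).comp (by unfold Finset.restrict; fun_prop)⟩

lemma continuous_restrict (Λ : Finset (Fin d → ℤ)) :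
    Continuous (Λ.restrict : Config d q → Λ → Fin q) := by
  unfold Finset.restrict; fun_prop

/-- The generator applied to `localFun Λ G`. -/
def localGen (c : Rates d q) (hc : ∀ x i, Continuous (c x i)) (Λ : Finset (Fin d → ℤ))
    (G : (Λ → Fin q) → ℝ) : C(Config d q, ℝ) :=
  ⟨fun η => ∑ x : Λ, ∑ i, c x i η *
      (G (Function.update (Λ.restrict η) x i) - G (Λ.restrict η)), by
    refine continuous_finsetSum _ fun x _ => continuous_finsetSum _ fun i _ => ?_
    refine (hc x i).mul ?_
    exact (continuous_of_discreteTopology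
      (f := fun σ : Λ → Fin q => G (Function.update σ x i) - G σ)).comp (continuous_restrict Λ)⟩

lemma restrict_update_of_mem {Λ : Finset (Fin d → ℤ)} (η : Config d q) (x : Λ) (i : Fin q) :
    Λ.restrict (Function.update η x i) = Function.update (Λ.restrict η) x i := by
  ext y
  by_cases h : y = x
  · subst h; simp [Finset.restrict]
  · have : (y : Fin d → ℤ) ≠ x := fun h' => h (Subtype.ext h')
    simp [Finset.restrict, Function.update_of_ne h, Function.update_of_ne this]

lemma restrict_update_of_notMem {Λ : Finset (Fin d → ℤ)} (η : Config d q) {x : Fin d → ℤ}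
    (hx : x ∉ Λ) (i : Fin q) : Λ.restrict (Function.update η x i) = Λ.restrict η := by
  ext y
  have : (y : Fin d → ℤ) ≠ x := fun h' => hx (h' ▸ y.2)
  simp [Finset.restrict, Function.update_of_ne this]

lemma tsum_osc_localFun_lt_top (Λ : Finset (Fin d → ℤ)) (G : (Λ → Fin q) → ℝ) :
    ∑' x, osc x (localFun Λ G) < ⊤ := by
  rw [tsum_eq_sum (s := Λ)]
  · refine ENNReal.sum_lt_top.2 fun x _ => ?_
    have hfin : ∑ σ, ∑ τ, edist (G σ) (G τ) < ⊤ :=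
      ENNReal.sum_lt_top.2 fun σ _ => ENNReal.sum_lt_top.2 fun τ _ => edist_lt_top _ _
    refine lt_of_le_of_lt ?_ hfin
    refine iSup_le fun η => iSup_le fun ξ => iSup_le fun _ => ?_
    exact (Finset.single_le_sum (f := fun τ => edist (G (Λ.restrict η)) (G τ))
      (fun _ _ => zero_le) (Finset.mem_univ (Λ.restrict ξ))).trans
      (Finset.single_le_sum (f := fun σ => ∑ τ, edist (G σ) (G τ))
      (fun _ _ => zero_le) (Finset.mem_univ (Λ.restrict η)))
  · intro x hx
    refine le_antisymm ?_ zero_le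
    refine iSup_le fun η => iSup_le fun ξ => iSup_le fun h => ?_
    have : Λ.restrict η = Λ.restrict ξ := by
      ext y
      have hy : (y : Fin d → ℤ) ≠ x := fun h' => hx (h' ▸ y.2)
      simp [Finset.restrict, h y hy]
    simp [localFun, this]

lemma localFun_mem_preGeneratorGraph (c : Rates d q) (hc : ∀ x i, Continuous (c x i))
    (Λ : Finset (Fin d → ℤ)) (G : (Λ → Fin q) → ℝ) :
    (localFun Λ G, localGen c hc Λ G) ∈ preGeneratorGraph c := by
  refine ⟨tsum_osc_localFun_lt_top Λ G, fun η => ?_⟩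
  have h : localGen c hc Λ G η = ∑ x ∈ Λ, ∑ i, c x i η *
      (localFun Λ G (Function.update η x i) - localFun Λ G η) := by
    rw [← Finset.sum_coe_sort]
    simp [localGen, localFun, restrict_update_of_mem]
  change HasSum _ (localGen c hc Λ G η)
  rw [h]
  refine hasSum_sum_of_ne_finset_zero fun x hx => ?_
  refine Finset.sum_eq_zero fun i _ => ?_
  simp [localFun, restrict_update_of_notMem η hx]

lemma localFun_mem_generatorGraph {P : MarkovSemigroup (Config d q)} {c : Rates d q}
    (hP : IsGeneratedBy P c) (hc : ∀ x i, Continuous (c x i))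
    (Λ : Finset (Fin d → ℤ)) (G : (Λ → Fin q) → ℝ) :
    (localFun Λ G, localGen c hc Λ G) ∈ P.generatorGraph := by
  rw [hP]
  exact subset_closure (localFun_mem_preGeneratorGraph c hc Λ G)

/-- The probability under `ν` of the cylinder of configurations that agree with `σ` on `Λ`. -/
def cyl (ν : Measure (Config d q)) (Λ : Finset (Fin d → ℤ)) (σ : Λ → Fin q) : ℝ :=
  ν.real (Λ.restrict ⁻¹' {σ})

lemma measurableSet_cylinder (Λ : Finset (Fin d → ℤ)) (σ : Λ → Fin q) :
    MeasurableSet (Λ.restrict ⁻¹' {σ} : Set (Config d q)) :=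
  Λ.measurable_restrict (measurableSet_singleton σ)

/-- The integral of `f` over the cylinder of configurations that agree with `σ` on `Λ`. -/
def cylIntegral (ν : Measure (Config d q)) (Λ : Finset (Fin d → ℤ)) (f : Config d q → ℝ)
    (σ : Λ → Fin q) : ℝ :=
  ∫ η in Λ.restrict ⁻¹' {σ}, f η ∂ν

lemma integral_eq_sum_cylIntegral (ν : Measure (Config d q)) (Λ : Finset (Fin d → ℤ))
    {f : Config d q → ℝ} (hf : Integrable f ν) :
    ∫ η, f η ∂ν = ∑ σ, cylIntegral ν Λ f σ := by
  have h := integral_iUnion_fintype (μ := ν) (f := f)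
    (s := fun σ : Λ → Fin q => (Λ.restrict ⁻¹' {σ} : Set (Config d q)))
    (fun σ => measurableSet_cylinder Λ σ)
    (fun σ τ hστ => Disjoint.preimage _ (Set.disjoint_singleton.2 hστ))
    (fun σ => hf.integrableOn)
  have hU : (⋃ σ : Λ → Fin q, (Λ.restrict ⁻¹' {σ} : Set (Config d q))) = Set.univ :=
    Set.eq_univ_of_forall fun η => Set.mem_iUnion.2 ⟨Λ.restrict η, rfl⟩
  rw [hU, setIntegral_univ] at h
  exact h

lemma cylIntegral_mul_local (ν : Measure (Config d q)) (Λ : Finset (Fin d → ℤ))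
    (f : Config d q → ℝ) (G : (Λ → Fin q) → ℝ) (σ : Λ → Fin q) :
    cylIntegral ν Λ (fun η => f η * G (Λ.restrict η)) σ = cylIntegral ν Λ f σ * G σ := by
  rw [cylIntegral, cylIntegral, ← integral_mul_const]
  refine setIntegral_congr_fun (measurableSet_cylinder Λ σ) fun η hη => ?_
  have : Λ.restrict η = σ := hη
  simp [this]

lemma cylIntegral_one (ν : Measure (Config d q)) (Λ : Finset (Fin d → ℤ)) (σ : Λ → Fin q) :
    cylIntegral ν Λ (fun _ => 1) σ = cyl ν Λ σ := by
  simp [cylIntegral, cyl, measureReal_def]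

lemma integrable_of_continuous {f : Config d q → ℝ} (hf : Continuous f)
    (ν : Measure (Config d q)) [IsFiniteMeasure ν] : Integrable f ν :=
  MarkovSemigroup.integrable_continuousMap ν ⟨f, hf⟩

lemma integral_localGen (c : Rates d q) (hc : ∀ x i, Continuous (c x i))
    (Λ : Finset (Fin d → ℤ)) (G : (Λ → Fin q) → ℝ) (ν : Measure (Config d q))
    [IsFiniteMeasure ν] :
    ∫ η, localGen c hc Λ G η ∂ν = ∑ x : Λ, ∑ i, ∑ σ, cylIntegral ν Λ (c x i) σ *
      (G (Function.update σ x i) - G σ) := by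
  have hint : ∀ (x : Λ) (i : Fin q), Integrable (fun η => c x i η *
      (G (Function.update (Λ.restrict η) x i) - G (Λ.restrict η))) ν := fun x i => by
    refine integrable_of_continuous ((hc x i).mul ?_) ν
    exact (continuous_of_discreteTopology
      (f := fun σ : Λ → Fin q => G (Function.update σ x i) - G σ)).comp (continuous_restrict Λ)
  simp only [localGen, ContinuousMap.coe_mk]
  rw [integral_finsetSum _ fun x _ => integrable_finsetSum _ fun i _ => hint x i]
  refine Finset.sum_congr rfl fun x _ => ?_
  rw [integral_finsetSum _ fun i _ => hint x i]
  refine Finset.sum_congr rfl fun i _ => ?_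
  rw [integral_eq_sum_cylIntegral ν Λ (hint x i)]
  refine Finset.sum_congr rfl fun σ _ => ?_
  exact cylIntegral_mul_local ν Λ (c x i)
    (fun σ => G (Function.update σ x i) - G σ) σ

lemma integral_localFun (Λ : Finset (Fin d → ℤ)) (G : (Λ → Fin q) → ℝ)
    (ν : Measure (Config d q)) [IsFiniteMeasure ν] :
    ∫ η, localFun Λ G η ∂ν = ∑ σ, cyl ν Λ σ * G σ := by
  rw [integral_eq_sum_cylIntegral ν Λ (MarkovSemigroup.integrable_continuousMap ν _)]
  refine Finset.sum_congr rfl fun σ _ => ?_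
  have := cylIntegral_mul_local ν Λ (fun _ => 1) G σ
  simp only [one_mul, cylIntegral_one] at this
  exact this

lemma cyl_eq_integral (Λ : Finset (Fin d → ℤ)) (σ : Λ → Fin q)
    (ν : Measure (Config d q)) [IsFiniteMeasure ν] :
    cyl ν Λ σ = ∫ η, localFun Λ (Pi.single σ 1) η ∂ν := by
  classical
  rw [integral_localFun]
  simp [Pi.single_apply]

/-- Linearity of the generator on local functions. -/
lemma integral_localGen_eq_sum (c : Rates d q) (hc : ∀ x i, Continuous (c x i))
    (Λ : Finset (Fin d → ℤ)) (G : (Λ → Fin q) → ℝ) (ν : Measure (Config d q))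
    [IsFiniteMeasure ν] :
    ∫ η, localGen c hc Λ G η ∂ν
      = ∑ σ, (∫ η, localGen c hc Λ (Pi.single σ 1) η ∂ν) * G σ := by
  classical
  simp_rw [← integral_mul_const]
  rw [← integral_finsetSum Finset.univ (f := fun σ η => localGen c hc Λ (Pi.single σ 1) η * G σ)
    fun σ _ => (MarkovSemigroup.integrable_continuousMap ν _).mul_const _]
  congr 1
  funext η
  simp only [localGen, ContinuousMap.coe_mk, Finset.sum_mul]
  rw [eq_comm, Finset.sum_comm]
  refine Finset.sum_congr rfl fun x _ => ?_
  rw [Finset.sum_comm]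
  refine Finset.sum_congr rfl fun i _ => ?_
  simp only [mul_assoc, ← Finset.mul_sum, sub_mul, Finset.sum_sub_distrib]
  simp [Pi.single_apply]

lemma sum_cyl (Λ : Finset (Fin d → ℤ)) (ν : Measure (Config d q)) [IsProbabilityMeasure ν] :
    ∑ σ, cyl ν Λ σ = 1 := by
  have := integral_localFun Λ (fun _ => 1) ν
  simpa [localFun] using this.symm

lemma cyl_nonneg (ν : Measure (Config d q)) (Λ : Finset (Fin d → ℤ)) (σ : Λ → Fin q) :
    0 ≤ cyl ν Λ σ := measureReal_nonneg

/-! ### Entropy dissipation in a finite box. -/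

/-- The dissipation estimate for a single transition, with `Gn`, `Gm` the integrals of the rate
over a cylinder. -/
lemma relEntropy_rate_le {κ a Gn Gm p m f f' : ℝ} (hκ : 0 ≤ κ) (hm : 0 < m) (hf : 0 < f)
    (hf' : 0 < f') (hp : p = m * f) (hGn : κ * p ≤ Gn) (hG : |Gn * m - Gm * p| ≤ a * p * m) :
    Gn * (Real.log f' - Real.log f) - Gm * (f' - f)
      ≤ -κ * (√(m * f) - √(m * f')) ^ 2 + a * |m * f - m * f'| := by
  subst hp
  have hs : 0 < √f := Real.sqrt_pos.2 hf
  have hs' : 0 < √f' := Real.sqrt_pos.2 hf'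
  have e1 : √f ^ 2 = f := Real.sq_sqrt hf.le
  have e2 : √f' ^ 2 = f' := Real.sq_sqrt hf'.le
  have e3 : √m ^ 2 = m := Real.sq_sqrt hm.le
  -- This is `log u ≤ u - 1` at `u = √f' / √f`, doubled and multiplied by `f`; using the square root
  -- keeps the quadratic gain.
  have hlog : f * (Real.log f' - Real.log f) ≤ (f' - f) - (√f - √f') ^ 2 := by
    have h1 : Real.log f' - Real.log f = 2 * Real.log (√f' / √f) := by
      rw [Real.log_div hs'.ne' hs.ne', Real.log_sqrt hf'.le, Real.log_sqrt hf.le]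
      ring
    have h2 := Real.log_le_sub_one_of_pos (div_pos hs' hs)
    have h3 : f * (√f' / √f - 1) = √f * √f' - f := by
      rw [mul_sub, mul_one]
      congr 1
      nth_rewrite 1 [← e1]
      field_simp
    rw [h1]
    nlinarith [mul_le_mul_of_nonneg_left h2 hf.le]
  -- `A / m` and `Gm / m` are the mean rates on the cylinder under the two measures, so they differ
  -- by at most `a`.
  obtain ⟨A, rfl⟩ : ∃ A, Gn = A * f := ⟨Gn / f, by field_simp⟩
  have hA : κ * m ≤ A := by
    have : κ * m * f ≤ A * f := by linarith
    exact le_of_mul_le_mul_right this hf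
  have hB : |A - Gm| ≤ a * m := by
    have h1 : A * f * m - Gm * (m * f) = (A - Gm) * (m * f) := by ring
    rw [h1, abs_mul, abs_of_pos (mul_pos hm hf)] at hG
    have h2 : |A - Gm| * (m * f) ≤ a * m * (m * f) := by linarith
    exact le_of_mul_le_mul_right h2 (mul_pos hm hf)
  have hA0 : 0 ≤ A := (mul_nonneg hκ hm.le).trans hA
  have h1 := mul_le_mul_of_nonneg_left hlog hA0
  have h2 : (A - Gm) * (f' - f) ≤ a * m * |f' - f| :=
    (le_abs_self _).trans ((abs_mul _ _).trans_le (mul_le_mul_of_nonneg_right hB (abs_nonneg _)))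
  have h3 : κ * m * (√f - √f') ^ 2 ≤ A * (√f - √f') ^ 2 :=
    mul_le_mul_of_nonneg_right hA (sq_nonneg _)
  have h4 : (√(m * f) - √(m * f')) ^ 2 = m * (√f - √f') ^ 2 := by
    rw [Real.sqrt_mul hm.le, Real.sqrt_mul hm.le, ← mul_sub, mul_pow, e3]
  have h5 : |m * f - m * f'| = m * |f' - f| := by
    rw [← mul_sub, abs_mul, abs_of_pos hm, abs_sub_comm]
  rw [h4, h5]
  linarith

/-- The Hellinger form at `x` of cylinder probabilities `p` relative to the product measure with
marginals `r`. -/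
def hellinger (r : (Fin d → ℤ) → Fin q → ℝ) (Λ : Finset (Fin d → ℤ)) (p : (Λ → Fin q) → ℝ)
    (x : Λ) : ℝ :=
  ∑ i, ∑ σ, (√(p σ) - √(r x (σ x) / r x i * p (Function.update σ x i))) ^ 2

lemma hellinger_nonneg (r : (Fin d → ℤ) → Fin q → ℝ) (Λ : Finset (Fin d → ℤ))
    (p : (Λ → Fin q) → ℝ) (x : Λ) : 0 ≤ hellinger r Λ p x :=
  Finset.sum_nonneg fun _ _ => Finset.sum_nonneg fun _ _ => sq_nonneg _

lemma sum_sum_update (Λ : Finset (Fin d → ℤ)) (p : (Λ → Fin q) → ℝ) (x : Λ) :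
    ∑ i : Fin q, ∑ σ, p (Function.update σ x i) = q * ∑ σ, p σ := by
  -- Exchanging the proposed spin `i` with the spin at `x` is a bijection of pairs `(i, σ)`.
  have hinv : Function.Involutive
      (fun z : Fin q × (Λ → Fin q) => (z.2 x, Function.update z.2 x z.1)) := fun z => by
    simp
  have h := Fintype.sum_equiv hinv.toPerm
    (fun z : Fin q × (Λ → Fin q) => p (Function.update z.2 x z.1)) (fun z => p z.2) fun z => rfl
  rw [Fintype.sum_prod_type, Fintype.sum_prod_type] at h
  rw [h]
  simp

/-- Cauchy–Schwarz for `|u - v| = |√u - √v| (√u + √v)`. The constant comes from `(√u + √v)² ≤ 2 (u +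
v)`: the first terms sum to `q`, the second to at most `q / ε`. -/
lemma sum_abs_sub_le_hellinger {r : (Fin d → ℤ) → Fin q → ℝ} {ε : ℝ} (hε : 0 < ε)
    (hr : ∀ x i, ε ≤ r x i) (hr1 : ∀ x i, r x i ≤ 1) (Λ : Finset (Fin d → ℤ))
    {p : (Λ → Fin q) → ℝ} (hp : ∀ σ, 0 ≤ p σ) (hp1 : ∑ σ, p σ = 1) (x : Λ) :
    ∑ i, ∑ σ, |p σ - r x (σ x) / r x i * p (Function.update σ x i)|
      ≤ √(2 * (q + q / ε)) * √(hellinger r Λ p x) := by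
  set v : Fin q → (Λ → Fin q) → ℝ :=
    fun i σ => r x (σ x) / r x i * p (Function.update σ x i) with hv
  have hr0 : ∀ x i, 0 < r x i := fun x i => hε.trans_le (hr x i)
  have hv0 : ∀ i σ, 0 ≤ v i σ := fun i σ =>
    mul_nonneg (div_nonneg (hr0 _ _).le (hr0 _ _).le) (hp _)
  have hv1 : ∀ i σ, v i σ ≤ p (Function.update σ x i) / ε := fun i σ => by
    have : r x (σ x) / r x i ≤ 1 / ε := div_le_div₀ zero_le_one (hr1 _ _) hε (hr _ _)
    calc v i σ ≤ 1 / ε * p (Function.update σ x i) := mul_le_mul_of_nonneg_right this (hp _)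
      _ = _ := by ring
  have hsum : ∑ i, ∑ σ, (√(p σ) + √(v i σ)) ^ 2 ≤ 2 * (q + q / ε) := by
    calc ∑ i, ∑ σ, (√(p σ) + √(v i σ)) ^ 2
        ≤ ∑ i : Fin q, ∑ σ, 2 * (p σ + p (Function.update σ x i) / ε) := by
          refine Finset.sum_le_sum fun i _ => Finset.sum_le_sum fun σ _ => ?_
          have h1 := Real.sq_sqrt (hp σ)
          have h2 := Real.sq_sqrt (hv0 i σ)
          nlinarith [sq_nonneg (√(p σ) - √(v i σ)), hv1 i σ]
      _ = 2 * (q + q / ε) := by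
          simp_rw [← Finset.mul_sum, Finset.sum_add_distrib, ← Finset.sum_div]
          rw [sum_sum_update, hp1]
          simp
  have hcs := Real.sum_mul_le_sqrt_mul_sqrt (Finset.univ : Finset (Fin q × (Λ → Fin q)))
    (fun z => |√(p z.2) - √(v z.1 z.2)|) (fun z => √(p z.2) + √(v z.1 z.2))
  simp only [sq_abs] at hcs
  rw [Fintype.sum_prod_type, Fintype.sum_prod_type, Fintype.sum_prod_type] at hcs
  have hL : ∀ i σ, |√(p σ) - √(v i σ)| * (√(p σ) + √(v i σ)) = |p σ - v i σ| := fun i σ => by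
    have h0 : 0 ≤ √(p σ) + √(v i σ) := by positivity
    have e0 := abs_of_nonneg h0
    rw [show |√(p σ) - √(v i σ)| * (√(p σ) + √(v i σ))
      = |√(p σ) - √(v i σ)| * |√(p σ) + √(v i σ)| by rw [e0]]
    rw [← abs_mul]
    congr 1
    have h1 := Real.sq_sqrt (hp σ)
    have h2 := Real.sq_sqrt (hv0 i σ)
    nlinarith
  simp only [hL] at hcs
  refine hcs.trans ?_
  rw [mul_comm]
  exact mul_le_mul_of_nonneg_right (Real.sqrt_le_sqrt hsum) (Real.sqrt_nonneg _)

/-- The integrals over a cylinder of a function with oscillation at most `a` there, under two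
different measures. -/
lemma abs_cylIntegral_mul_sub_le (ν μ : Measure (Config d q)) [IsProbabilityMeasure ν]
    [IsProbabilityMeasure μ] (Λ : Finset (Fin d → ℤ)) {f : Config d q → ℝ} (hf : Continuous f)
    (σ : Λ → Fin q) {a : ℝ}
    (ha : ∀ η ξ : Config d q, Λ.restrict η = σ → Λ.restrict ξ = σ → |f η - f ξ| ≤ a) :
    |cylIntegral ν Λ f σ * cyl μ Λ σ - cylIntegral μ Λ f σ * cyl ν Λ σ|
      ≤ a * cyl ν Λ σ * cyl μ Λ σ := by
  have hi : ∀ (π : Measure (Config d q)) [IsProbabilityMeasure π],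
      IntegrableOn f (Λ.restrict ⁻¹' {σ}) π := fun π _ => (integrable_of_continuous hf π).integrableOn
  -- Compare with a fixed reference configuration `ξ` under `ν` first, then average `ξ` over the
  -- cylinder under `μ`.
  have h1 : ∀ ξ : Config d q, Λ.restrict ξ = σ →
      |cylIntegral ν Λ f σ - f ξ * cyl ν Λ σ| ≤ a * cyl ν Λ σ := fun ξ hξ => by
    have e : cylIntegral ν Λ f σ - f ξ * cyl ν Λ σ
        = ∫ η in Λ.restrict ⁻¹' {σ}, (f η - f ξ) ∂ν := by
      rw [integral_sub (hi ν) (integrable_const _)]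
      simp [cylIntegral, cyl, measureReal_def, mul_comm]
    rw [e]
    exact norm_setIntegral_le_of_norm_le_const (f := fun η => f η - f ξ) (C := a)
      (measure_lt_top _ _)
      (fun η hη => ha η ξ hη hξ)
  have e : cylIntegral ν Λ f σ * cyl μ Λ σ - cylIntegral μ Λ f σ * cyl ν Λ σ
      = ∫ ξ in Λ.restrict ⁻¹' {σ}, (cylIntegral ν Λ f σ - f ξ * cyl ν Λ σ) ∂μ := by
    rw [integral_sub (integrable_const _) ((hi μ).mul_const _), integral_mul_const]
    simp [cylIntegral, cyl, measureReal_def, mul_comm]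
  rw [e]
  exact norm_setIntegral_le_of_norm_le_const
    (f := fun ξ => cylIntegral ν Λ f σ - f ξ * cyl ν Λ σ) (C := a * cyl ν Λ σ)
    (measure_lt_top _ _) (fun ξ hξ => h1 ξ hξ)

lemma mul_cyl_le_cylIntegral (ν : Measure (Config d q)) [IsProbabilityMeasure ν]
    (Λ : Finset (Fin d → ℤ)) {f : Config d q → ℝ} (hf : Continuous f) {κ : ℝ}
    (hκ : ∀ η, κ ≤ f η) (σ : Λ → Fin q) : κ * cyl ν Λ σ ≤ cylIntegral ν Λ f σ := by
  have h := setIntegral_mono (μ := ν) (s := Λ.restrict ⁻¹' {σ}) (f := fun _ => κ) (g := f)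
    (integrable_const _) (integrable_of_continuous hf ν).integrableOn hκ
  simpa [cylIntegral, cyl, measureReal_def, mul_comm] using h

lemma cyl_eq_prod {μ : ProbabilityMeasure (Config d q)}
    {ρ : (Fin d → ℤ) → ProbabilityMeasure (Fin q)}
    (hμ : (μ : Measure (Config d q)) = Measure.infinitePi fun x => (ρ x : Measure (Fin q)))
    (Λ : Finset (Fin d → ℤ)) (σ : Λ → Fin q) :
    cyl (μ : Measure (Config d q)) Λ σ = ∏ x : Λ, (ρ x : Measure (Fin q)).real {σ x} := by
  rw [cyl, measureReal_def, ← Measure.map_apply Λ.measurable_restrict (measurableSet_singleton σ),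
    hμ, Measure.infinitePi_map_restrict, Measure.pi_singleton, ENNReal.toReal_prod]
  rfl

/-- The effect of the product structure: changing one spin alters the weight by a factor that
ignores all other sites. -/
lemma prod_update_div {r : (Fin d → ℤ) → Fin q → ℝ} (hr : ∀ x i, 0 < r x i)
    (Λ : Finset (Fin d → ℤ)) (σ : Λ → Fin q) (x : Λ) (i : Fin q) :
    (∏ y : Λ, r y (σ y)) / (∏ y : Λ, r y (Function.update σ x i y)) = r x (σ x) / r x i := by
  classical
  rw [← Finset.mul_prod_erase _ _ (Finset.mem_univ x),
    ← Finset.mul_prod_erase _ (fun y : Λ => r y (Function.update σ x i y)) (Finset.mem_univ x),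
    Function.update_self]
  have : ∏ y ∈ Finset.univ.erase x, r y (Function.update σ x i y)
      = ∏ y ∈ Finset.univ.erase x, r y (σ y) :=
    Finset.prod_congr rfl fun y hy => by
      rw [Function.update_of_ne (Finset.ne_of_mem_erase hy)]
  rw [this]
  refine mul_div_mul_right _ _ (Finset.prod_ne_zero_iff.2 fun y _ => (hr _ _).ne')

/-- The entropy inequality at a fixed time. -/
lemma integral_localGen_log_le {c : Rates d q} (hc : ∀ x i, Continuous (c x i)) {κ : ℝ}
    (hκ : 0 ≤ κ) (hcκ : ∀ x i η, κ ≤ c x i η) {r : (Fin d → ℤ) → Fin q → ℝ} {ε : ℝ} (hε : 0 < ε)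
    (hr : ∀ x i, ε ≤ r x i) (hr1 : ∀ x i, r x i ≤ 1) (ν μ : Measure (Config d q))
    [IsProbabilityMeasure ν] [IsProbabilityMeasure μ] (Λ : Finset (Fin d → ℤ))
    (hμ : ∀ σ, cyl μ Λ σ = ∏ y : Λ, r y (σ y)) (hν : ∀ σ, 0 < cyl ν Λ σ)
    (hst : ∀ G, ∫ η, localGen c hc Λ G η ∂μ = 0) {a : Λ → ℝ} (ha0 : ∀ x, 0 ≤ a x)
    (ha : ∀ (x : Λ) (i : Fin q) (η ξ : Config d q), Λ.restrict η = Λ.restrict ξ → η x ≠ i →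
      |c x i η - c x i ξ| ≤ a x) :
    ∫ η, localGen c hc Λ (fun σ => Real.log (cyl ν Λ σ / cyl μ Λ σ) + 1) η ∂ν
      ≤ -κ * ∑ x, hellinger r Λ (cyl ν Λ) x
        + √(2 * (q + q / ε)) * ∑ x, a x * √(hellinger r Λ (cyl ν Λ) x) := by
  have hr0 : ∀ x i, 0 < r x i := fun x i => hε.trans_le (hr x i)
  have hm : ∀ σ, 0 < cyl μ Λ σ := fun σ => by
    rw [hμ]; exact Finset.prod_pos fun y _ => hr0 _ _
  set f : (Λ → Fin q) → ℝ := fun σ => cyl ν Λ σ / cyl μ Λ σ with hf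
  have hf0 : ∀ σ, 0 < f σ := fun σ => div_pos (hν σ) (hm σ)
  have hmf : ∀ σ, cyl ν Λ σ = cyl μ Λ σ * f σ := fun σ => by
    rw [hf]; field_simp [(hm σ).ne']
  have hmf' : ∀ σ (x : Λ) (i : Fin q), cyl μ Λ σ * f (Function.update σ x i)
      = r x (σ x) / r x i * cyl ν Λ (Function.update σ x i) := fun σ x i => by
    rw [← prod_update_div hr0 Λ σ x i, ← hμ, ← hμ, hf]
    ring
  -- Stationarity is tested on the density `f` itself; this vanishing quantity is subtracted to
  -- cancel the first-order part of the entropy production.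
  have h0 := hst f
  rw [integral_localGen] at h0
  rw [integral_localGen]
  rw [← sub_zero (∑ x : Λ, _), ← h0, ← Finset.sum_sub_distrib, Finset.mul_sum, Finset.mul_sum,
    ← Finset.sum_add_distrib]
  refine Finset.sum_le_sum fun x _ => ?_
  have hx : ∀ i σ, cylIntegral ν Λ (c x i) σ *
        ((Real.log (f (Function.update σ x i)) + 1) - (Real.log (f σ) + 1)) -
      cylIntegral μ Λ (c x i) σ * (f (Function.update σ x i) - f σ)
      ≤ -κ * (√(cyl ν Λ σ) - √(r x (σ x) / r x i * cyl ν Λ (Function.update σ x i))) ^ 2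
        + a x * |cyl ν Λ σ - r x (σ x) / r x i * cyl ν Λ (Function.update σ x i)| := by
    intro i σ
    -- When the spin already equals `i` both sides vanish, so the oscillation bound is needed only
    -- for actual jumps.
    by_cases hi : σ x = i
    · subst hi
      simp [div_self (hr0 _ _).ne']
    · rw [add_sub_add_right_eq_sub, ← hmf', hmf σ]
      refine relEntropy_rate_le (p := cyl ν Λ σ) hκ (hm σ) (hf0 _) (hf0 _) (hmf σ)
        (mul_cyl_le_cylIntegral ν Λ (hc x i) (hcκ x i) σ)
        (abs_cylIntegral_mul_sub_le ν μ Λ (hc x i) σ fun η ξ hη hξ => ?_)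
      refine ha x i η ξ (hη.trans hξ.symm) ?_
      rw [← hη] at hi
      exact hi
  calc _ = ∑ i, ∑ σ, (cylIntegral ν Λ (c x i) σ *
        ((Real.log (f (Function.update σ x i)) + 1) - (Real.log (f σ) + 1)) -
      cylIntegral μ Λ (c x i) σ * (f (Function.update σ x i) - f σ)) := by
        simp only [Finset.sum_sub_distrib, hf]
    _ ≤ ∑ i, ∑ σ, (-κ * (√(cyl ν Λ σ) -
          √(r x (σ x) / r x i * cyl ν Λ (Function.update σ x i))) ^ 2
        + a x * |cyl ν Λ σ - r x (σ x) / r x i * cyl ν Λ (Function.update σ x i)|) :=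
        Finset.sum_le_sum fun i _ => Finset.sum_le_sum fun σ _ => hx i σ
    _ = -κ * hellinger r Λ (cyl ν Λ) x + a x * ∑ i, ∑ σ,
          |cyl ν Λ σ - r x (σ x) / r x i * cyl ν Λ (Function.update σ x i)| := by
        simp only [Finset.sum_add_distrib, ← Finset.mul_sum, hellinger]
    _ ≤ _ := by
        have := mul_le_mul_of_nonneg_left (sum_abs_sub_le_hellinger hε hr hr1 Λ
          (cyl_nonneg ν Λ) (sum_cyl Λ ν) x) (ha0 x)
        linarith

/-! ### Monotonicity of the Hellinger form in the region. -/

lemma sq_sqrt_sum_sub_sqrt_sum_le {ι : Type*} (s : Finset ι) {u v : ι → ℝ} (hu : ∀ i, 0 ≤ u i)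
    (hv : ∀ i, 0 ≤ v i) :
    (√(∑ i ∈ s, u i) - √(∑ i ∈ s, v i)) ^ 2 ≤ ∑ i ∈ s, (√(u i) - √(v i)) ^ 2 := by
  have h1 := Real.sum_sqrt_mul_sqrt_le s hu hv
  have e : ∑ i ∈ s, (√(u i) - √(v i)) ^ 2
      = ∑ i ∈ s, u i + ∑ i ∈ s, v i - 2 * ∑ i ∈ s, √(u i) * √(v i) := by
    rw [Finset.mul_sum, ← Finset.sum_add_distrib, ← Finset.sum_sub_distrib]
    refine Finset.sum_congr rfl fun i _ => ?_
    rw [sub_sq, Real.sq_sqrt (hu i), Real.sq_sqrt (hv i)]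
    ring
  rw [e, sub_sq, Real.sq_sqrt (Finset.sum_nonneg fun i _ => hu i),
    Real.sq_sqrt (Finset.sum_nonneg fun i _ => hv i)]
  linarith

/-- Marginalising contracts the squared Hellinger distance. It applies because the weight `r x (σ x)
/ r x i` is constant on each fibre of the restriction from `Λ'` to `Λ`. -/
lemma hellinger_mono {r : (Fin d → ℤ) → Fin q → ℝ} (hr : ∀ x i, 0 < r x i)
    {Λ Λ' : Finset (Fin d → ℤ)} (h : Λ ⊆ Λ') {p : (Λ → Fin q) → ℝ} {p' : (Λ' → Fin q) → ℝ}
    (hp' : ∀ τ, 0 ≤ p' τ)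
    (hpp' : ∀ σ, p σ = ∑ τ with (fun y : Λ => τ ⟨y, h y.2⟩) = σ, p' τ) (x : Λ) :
    hellinger r Λ p x ≤ hellinger r Λ' p' ⟨x, h x.2⟩ := by
  classical
  refine Finset.sum_le_sum fun i _ => ?_
  have hrestr : ∀ (τ : Λ' → Fin q) (j : Fin q),
      (fun y : Λ => Function.update τ ⟨x, h x.2⟩ j ⟨y, h y.2⟩)
        = Function.update (fun y : Λ => τ ⟨y, h y.2⟩) x j := fun τ j => by
    ext y
    by_cases hy : y = x
    · subst hy; simp
    · have : (⟨y, h y.2⟩ : Λ') ≠ ⟨x, h x.2⟩ := fun h' =>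
        hy (Subtype.ext (congrArg (fun z : Λ' => (z : Fin d → ℤ)) h'))
      rw [Function.update_of_ne hy, Function.update_of_ne this]
  have hup : ∀ σ, p (Function.update σ x i)
      = ∑ τ with (fun y : Λ => τ ⟨y, h y.2⟩) = σ, p' (Function.update τ ⟨x, h x.2⟩ i) := fun σ => by
    rw [hpp']
    -- The fibres over `Function.update σ x i` and over `σ` are matched by resetting the spin at
    -- `x`.
    refine Finset.sum_bij' (fun τ _ => Function.update τ ⟨x, h x.2⟩ (σ x))
      (fun τ _ => Function.update τ ⟨x, h x.2⟩ i) ?_ ?_ ?_ ?_ ?_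
    · intro τ hτ
      simp only [Finset.mem_filter, Finset.mem_univ, true_and] at hτ ⊢
      rw [hrestr, hτ]
      simp
    · intro τ hτ
      simp only [Finset.mem_filter, Finset.mem_univ, true_and] at hτ ⊢
      rw [hrestr, hτ]
    · intro τ hτ
      simp only [Finset.mem_filter, Finset.mem_univ, true_and] at hτ
      have := congrFun hτ x
      simp only [Function.update_self] at this
      simp [← this]
    · intro τ hτ
      simp only [Finset.mem_filter, Finset.mem_univ, true_and] at hτ
      simp [← hτ]
    · intro τ hτ
      simp only [Finset.mem_filter, Finset.mem_univ, true_and] at hτ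
      have := congrFun hτ x
      simp only [Function.update_self] at this
      simp [← this]
  rw [← Finset.sum_fiberwise Finset.univ (fun τ : Λ' → Fin q => fun y : Λ => τ ⟨y, h y.2⟩)]
  refine Finset.sum_le_sum fun σ _ => ?_
  rw [hup, hpp', Finset.mul_sum]
  refine (sq_sqrt_sum_sub_sqrt_sum_le _ hp' fun τ => mul_nonneg
    (div_nonneg (hr x (σ x)).le (hr x i).le) (hp' _)).trans_eq ?_
  refine Finset.sum_congr rfl fun τ hτ => ?_
  simp only [Finset.mem_filter, Finset.mem_univ, true_and] at hτ
  rw [← hτ]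

lemma cyl_eq_sum (ν : Measure (Config d q)) [IsFiniteMeasure ν] {Λ Λ' : Finset (Fin d → ℤ)}
    (h : Λ ⊆ Λ') (σ : Λ → Fin q) :
    cyl ν Λ σ = ∑ τ with (fun y : Λ => τ ⟨y, h y.2⟩) = σ, cyl ν Λ' τ := by
  classical
  rw [cyl_eq_integral]
  have : localFun Λ (Pi.single σ 1) = localFun Λ' fun τ : Λ' → Fin q =>
      (Pi.single σ 1 : (Λ → Fin q) → ℝ) (fun y : Λ => τ ⟨y, h y.2⟩) := rfl
  rw [this, integral_localFun, Finset.sum_filter]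
  refine Finset.sum_congr rfl fun τ _ => ?_
  simp [Pi.single_apply]

/-! ### Influence of distant sites on the rates. -/

lemma edist_piecewise_le_sum_osc (f : Config d q → ℝ) (η ξ : Config d q)
    (s : Finset (Fin d → ℤ)) :
    edist (f η) (f (s.piecewise ξ η)) ≤ ∑ y ∈ s, if η y = ξ y then 0 else osc y f := by
  induction s using Finset.induction_on with
  | empty => simp
  | insert y s hy ih =>
    rw [Finset.sum_insert hy, add_comm]
    refine (edist_triangle _ (f (s.piecewise ξ η)) _).trans (add_le_add ih ?_)
    rw [Finset.piecewise_insert]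
    split_ifs with h
    · have : s.piecewise ξ η y = ξ y := by rw [Finset.piecewise_eq_of_notMem _ _ _ hy, h]
      rw [← this, Function.update_eq_self, edist_self]
    · refine le_iSup_of_le (s.piecewise ξ η) (le_iSup_of_le
        (Function.update (s.piecewise ξ η) y (ξ y)) (le_iSup_of_le (fun z hz => ?_) le_rfl))
      rw [Function.update_of_ne hz]

lemma tendsto_piecewise_atTop (η ξ : Config d q) :
    Tendsto (fun s : Finset (Fin d → ℤ) => s.piecewise ξ η) atTop (𝓝 ξ) := by
  refine tendsto_pi_nhds.2 fun y => tendsto_const_nhds.congr' ?_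
  filter_upwards [eventually_ge_atTop {y}] with s hs
  rw [Finset.piecewise_eq_of_mem _ _ _ (hs (Finset.mem_singleton_self y))]

/-- Replace the spins of `η` by those of `ξ` one site at a time; continuity passes the bound from
finitely many replacements to all of them. -/
lemma edist_le_tsum_osc {f : Config d q → ℝ} (hf : Continuous f) {Λ : Finset (Fin d → ℤ)}
    {η ξ : Config d q} (h : Λ.restrict η = Λ.restrict ξ) :
    edist (f η) (f ξ) ≤ ∑' y, if y ∈ Λ then 0 else osc y f := by
  have h1 : Tendsto (fun s : Finset (Fin d → ℤ) => edist (f η) (f (s.piecewise ξ η))) atTop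
      (𝓝 (edist (f η) (f ξ))) :=
    tendsto_const_nhds.edist ((hf.tendsto ξ).comp (tendsto_piecewise_atTop η ξ))
  refine le_of_tendsto' h1 fun s => (edist_piecewise_le_sum_osc f η ξ s).trans ?_
  refine le_trans (Finset.sum_le_sum fun y _ => ?_) (ENNReal.sum_le_tsum s)
  by_cases hy : y ∈ Λ
  · have : η y = ξ y := congrFun h ⟨y, hy⟩
    simp [this]
  · simp only [hy, if_false]
    split_ifs <;> simp

lemma continuous_jumpRate {c : Rates d q} (hc : ∀ x i, Continuous (c x i)) (x : Fin d → ℤ)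
    (i : Fin q) : Continuous (jumpRate c x i) := by
  have h : jumpRate c x i = fun η => (if η x = i then 0 else 1) * c x i η := by
    funext η
    simp only [jumpRate]
    split_ifs <;> simp
  rw [h]
  exact ((continuous_of_discreteTopology (f := fun j : Fin q => if j = i then (0 : ℝ) else 1)).comp
    (continuous_apply x)).mul (hc x i)

/-- The influence at relative position `z` on the rates. -/
def influence (c : Rates d q) (z : Fin d → ℤ) : ℝ≥0∞ :=
  ⨆ x, ∑ i, osc (x + z) (jumpRate c x i)

/-- The influence on the rates at `x` of the sites outside of `Λ`. -/
def outerInfluence (c : Rates d q) (Λ : Finset (Fin d → ℤ)) (x : Fin d → ℤ) : ℝ≥0∞ :=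
  ∑' z, if x + z ∈ Λ then 0 else influence c z

lemma edist_rate_le_outerInfluence {c : Rates d q} (hc : ∀ x i, Continuous (c x i))
    (Λ : Finset (Fin d → ℤ)) (x : Λ) (i : Fin q) {η ξ : Config d q}
    (h : Λ.restrict η = Λ.restrict ξ) (hi : η x ≠ i) :
    edist (c x i η) (c x i ξ) ≤ outerInfluence c Λ x := by
  have hx : η x = ξ x := congrFun h x
  have h1 := edist_le_tsum_osc (continuous_jumpRate hc x i) h
  -- Both configurations have the same spin at `x ∈ Λ`, different from `i`, so `jumpRate` is the
  -- true rate at both.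
  simp only [jumpRate, if_neg hi, if_neg (hx ▸ hi)] at h1
  refine h1.trans ?_
  rw [outerInfluence, ← (Equiv.addLeft (x : Fin d → ℤ)).tsum_eq]
  refine ENNReal.tsum_le_tsum fun z => ?_
  simp only [Equiv.coe_addLeft]
  by_cases hz : (x : Fin d → ℤ) + z ∈ Λ
  · simp only [hz, if_true, le_refl]
  · simp only [hz, if_false]
    refine le_trans ?_ (le_iSup (fun x => ∑ i, osc (x + z) (jumpRate c x i)) (x : Fin d → ℤ))
    exact Finset.single_le_sum (f := fun i => osc ((x : Fin d → ℤ) + z) (jumpRate c x i))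
      (fun _ _ => zero_le) (Finset.mem_univ i)

lemma Rates.Regular.exists_le {c : Rates d q} (hc : c.Regular) :
    ∃ K : ℝ, 0 < K ∧ ∀ x i η, c x i η ≤ K := by
  refine ⟨(⨆ x, ∑ i, ⨆ η, ‖c x i η‖ₑ).toReal + 1, by positivity, fun x i η => ?_⟩
  have h : ‖c x i η‖ₑ ≤ ⨆ x, ∑ i, ⨆ η, ‖c x i η‖ₑ :=
    (le_iSup (fun η => ‖c x i η‖ₑ) η).trans
    ((Finset.single_le_sum (f := fun i => ⨆ η, ‖c x i η‖ₑ) (fun _ _ => zero_le)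
      (Finset.mem_univ i)).trans (le_iSup (fun x => ∑ i, ⨆ η, ‖c x i η‖ₑ) x))
  have h2 := ENNReal.toReal_mono hc.bounded.ne h
  rw [toReal_enorm] at h2
  exact (le_abs_self _).trans (h2.trans (by linarith))

/-! ### Lower bound on the marginals of a stationary measure. -/

/-- The single-site probabilities of a stationary measure are bounded below. -/
lemma le_mul_cyl_singleton {c : Rates d q} (hc : ∀ x i, Continuous (c x i)) {κ K : ℝ}
    (hcκ : ∀ x i η, κ ≤ c x i η) (hcK : ∀ x i η, c x i η ≤ K) (μ : Measure (Config d q))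
    [IsProbabilityMeasure μ] (hst : ∀ Λ G, ∫ η, localGen c hc Λ G η ∂μ = 0) (x : Fin d → ℤ)
    (i : Fin q) : κ ≤ q * K * cyl μ {x} (fun _ => i) := by
  classical
  set G : (({x} : Finset (Fin d → ℤ)) → Fin q) → ℝ := Pi.single (fun _ => i) 1 with hG
  -- On the indicator `G` of spin `i` at `x`, the generator is the rate into `i` minus `G` times the
  -- sum of the rates over all target spins, hence at least `κ - q K G`.
  have h1 : ∫ η, (κ - q * K * localFun {x} G η) ∂μ ≤ ∫ η, localGen c hc {x} G η ∂μ := by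
    refine integral_mono ((integrable_const _).sub
      ((MarkovSemigroup.integrable_continuousMap μ _).const_mul _))
      (MarkovSemigroup.integrable_continuousMap μ _) fun η => ?_
    have hup : ∀ (y : ({x} : Finset (Fin d → ℤ))) (j : Fin q),
        G (Function.update (Finset.restrict {x} η) y j) = if j = i then 1 else 0 := fun y j => by
      rw [hG, Pi.single_apply]
      congr 1
      rw [eq_iff_iff]
      refine ⟨fun h => ?_, fun h => ?_⟩
      · have := congrFun h y
        simpa using this
      · ext z
        rw [Subsingleton.elim z y]
        simp [h]
    have hG0 : 0 ≤ G (Finset.restrict {x} η) := by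
      rw [hG, Pi.single_apply]; split_ifs <;> simp
    simp only [localGen, localFun, ContinuousMap.coe_mk, hup]
    rw [Finset.univ_unique, Finset.sum_singleton]
    have hx : ((default : ({x} : Finset (Fin d → ℤ))) : Fin d → ℤ) = x := rfl
    rw [hx]
    simp only [mul_sub, Finset.sum_sub_distrib, ← Finset.sum_mul]
    have h2 : ∑ j, c x j η ≤ q * K := by
      have := Finset.sum_le_card_nsmul Finset.univ (fun j => c x j η) K fun j _ => hcK x j η
      simpa using this
    have h3 := mul_le_mul_of_nonneg_right h2 hG0
    have h4 := hcκ x i η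
    simp only [mul_ite, mul_one, mul_zero, Finset.sum_ite_eq', Finset.mem_univ, if_true]
    linarith
  rw [hst, integral_sub (integrable_const _)
    ((MarkovSemigroup.integrable_continuousMap μ _).const_mul _), integral_const_mul, hG,
    ← cyl_eq_integral] at h1
  simp at h1
  linarith

/-! ### Boxes, and sums of the outer influence over sites and over scales. -/

/-- The box of side length `2 n + 1` around the origin. -/
def box (d n : ℕ) : Finset (Fin d → ℤ) := Fintype.piFinset fun _ => Finset.Icc (-n : ℤ) n

/-- The maximum of the absolute values of the coordinates. -/
def siteNorm (x : Fin d → ℤ) : ℕ := Finset.univ.sup fun j => (x j).natAbs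

lemma mem_box {n : ℕ} {x : Fin d → ℤ} : x ∈ box d n ↔ siteNorm x ≤ n := by
  simp only [box, siteNorm, Fintype.mem_piFinset, Finset.mem_Icc, Finset.sup_le_iff,
    Finset.mem_univ, true_imp_iff]
  exact forall_congr' fun j => by omega

lemma siteNorm_add_le (x z : Fin d → ℤ) : siteNorm (x + z) ≤ siteNorm x + siteNorm z := by
  refine Finset.sup_le fun j _ => ?_
  have h1 : (x j).natAbs ≤ siteNorm x :=
    Finset.le_sup (f := fun j => (x j).natAbs) (Finset.mem_univ j)
  have h2 : (z j).natAbs ≤ siteNorm z :=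
    Finset.le_sup (f := fun j => (z j).natAbs) (Finset.mem_univ j)
  exact (Int.natAbs_add_le _ _).trans (add_le_add h1 h2)

lemma siteNorm_le_enorm (z : Fin d → ℤ) : (siteNorm z : ℝ≥0∞) ≤ ‖z‖ₑ := by
  have h : siteNorm z ≤ ⌊‖z‖⌋₊ := Finset.sup_le fun j _ => Nat.le_floor <| by
    have h := norm_le_pi_norm z j
    rwa [Int.norm_eq_abs, ← Int.cast_abs, Int.abs_eq_natAbs, Int.cast_natCast] at h
  have h2 : (siteNorm z : ℝ) ≤ ‖z‖ := (Nat.cast_le.2 h).trans (Nat.floor_le (norm_nonneg z))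
  rw [← ofReal_norm, ← ENNReal.ofReal_natCast]
  exact ENNReal.ofReal_le_ofReal h2

lemma box_mono {m n : ℕ} (h : m ≤ n) : box d m ⊆ box d n := fun _ hx =>
  mem_box.2 ((mem_box.1 hx).trans h)

lemma exists_subset_box (Λ : Finset (Fin d → ℤ)) : ∃ n, Λ ⊆ box d n :=
  ⟨Λ.sup siteNorm, fun _ hx => mem_box.2 (Finset.le_sup hx)⟩

lemma card_filter_Icc_add_notMem_le (n : ℕ) (z : ℤ) :
    ((Finset.Icc (-n : ℤ) n).filter fun m => m + z ∉ Finset.Icc (-n : ℤ) n).card ≤ z.natAbs := by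
  rcases le_total 0 z with hz | hz
  · refine (Finset.card_le_card (t := Finset.Ioc ((n : ℤ) - z) n) fun m hm => ?_).trans ?_
    · simp only [Finset.mem_filter, Finset.mem_Icc, Finset.mem_Ioc] at hm ⊢
      omega
    · rw [Int.card_Ioc]; omega
  · refine (Finset.card_le_card (t := Finset.Ico (-n : ℤ) (-n - z)) fun m hm => ?_).trans ?_
    · simp only [Finset.mem_filter, Finset.mem_Icc, Finset.mem_Ico] at hm ⊢
      omega
    · rw [Int.card_Ico]; omega

/-- A translate leaves the box through some coordinate `j`; that coordinate has at most `|z j|`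
values and each other one at most `2 n + 1`. -/
lemma card_filter_box_add_notMem_le (n : ℕ) (z : Fin d → ℤ) :
    ((box d n).filter fun x => x + z ∉ box d n).card
      ≤ d * (2 * n + 1) ^ (d - 1) * siteNorm z := by
  classical
  have hsub : ((box d n).filter fun x => x + z ∉ box d n) ⊆ Finset.univ.biUnion fun j : Fin d =>
      Fintype.piFinset fun k => if k = j
        then (Finset.Icc (-n : ℤ) n).filter fun m => m + z j ∉ Finset.Icc (-n : ℤ) n
        else Finset.Icc (-n : ℤ) n := fun x hx => by
    simp only [Finset.mem_filter, box, Fintype.mem_piFinset, not_forall] at hx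
    obtain ⟨hx, j, hj⟩ := hx
    refine Finset.mem_biUnion.2 ⟨j, Finset.mem_univ j, Fintype.mem_piFinset.2 fun k => ?_⟩
    split_ifs with hk
    · subst hk
      exact Finset.mem_filter.2 ⟨hx k, hj⟩
    · exact hx k
  refine (Finset.card_le_card hsub).trans (Finset.card_biUnion_le.trans ?_)
  have : ∀ j : Fin d, (Fintype.piFinset fun k => if k = j
        then (Finset.Icc (-n : ℤ) n).filter fun m => m + z j ∉ Finset.Icc (-n : ℤ) n
        else Finset.Icc (-n : ℤ) n).card ≤ (2 * n + 1) ^ (d - 1) * siteNorm z := fun j => by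
    rw [Fintype.card_piFinset, ← Finset.mul_prod_erase _ _ (Finset.mem_univ j), if_pos rfl,
      mul_comm]
    refine Nat.mul_le_mul ?_ ((card_filter_Icc_add_notMem_le n (z j)).trans
      (Finset.le_sup (f := fun j => (z j).natAbs) (Finset.mem_univ j)))
    rw [Finset.prod_congr rfl (g := fun _ => 2 * n + 1) fun k hk => by
      rw [if_neg (Finset.ne_of_mem_erase hk), Int.card_Icc]; omega]
    simp
  refine (Finset.sum_le_card_nsmul _ _ _ fun j _ => this j).trans_eq ?_
  simp [mul_assoc]

/-- The first moment of the influence. -/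
def influenceMoment (c : Rates d q) : ℝ≥0∞ := ∑' z, ‖z‖ₑ * influence c z

lemma sum_outerInfluence_box_le (c : Rates d q) (n : ℕ) :
    ∑ x ∈ box d n, outerInfluence c (box d n) x
      ≤ (d * (2 * n + 1) ^ (d - 1) : ℕ) * influenceMoment c := by
  simp only [outerInfluence]
  rw [← Summable.tsum_finsetSum fun _ _ => ENNReal.summable, influenceMoment,
    ← ENNReal.tsum_mul_left]
  refine ENNReal.tsum_le_tsum fun z => ?_
  have h : ∑ x ∈ box d n, (if x + z ∈ box d n then 0 else influence c z)
      = ((box d n).filter fun x => x + z ∉ box d n).card * influence c z := by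
    rw [Finset.card_eq_sum_ones, Nat.cast_sum, Finset.sum_mul, Finset.sum_filter]
    refine Finset.sum_congr rfl fun x _ => ?_
    by_cases hx : x + z ∈ box d n <;> simp [hx]
  rw [h, ← mul_assoc]
  gcongr
  calc (((box d n).filter fun x => x + z ∉ box d n).card : ℝ≥0∞)
      ≤ ((d * (2 * n + 1) ^ (d - 1) * siteNorm z : ℕ) : ℝ≥0∞) :=
        Nat.cast_le.2 (card_filter_box_add_notMem_le n z)
    _ = (d * (2 * n + 1) ^ (d - 1) : ℕ) * (siteNorm z : ℝ≥0∞) := by push_cast; ring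
    _ ≤ _ := by gcongr; exact siteNorm_le_enorm z

/-- The pair `(x, x + z)` is separated by the `n`-th box only if `|x| ≤ n < |x + z| ≤ |x| + |z|`,
that is, for at most `|z|` values of `n`. -/
lemma sum_outerInfluence_range_le (c : Rates d q) (x : Fin d → ℤ) (N : ℕ) :
    ∑ n ∈ Finset.range N with x ∈ box d n, outerInfluence c (box d n) x
      ≤ influenceMoment c := by
  simp only [outerInfluence]
  rw [← Summable.tsum_finsetSum fun _ _ => ENNReal.summable, influenceMoment]
  refine ENNReal.tsum_le_tsum fun z => ?_
  have h : ∑ n ∈ Finset.range N with x ∈ box d n, (if x + z ∈ box d n then 0 else influence c z)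
      = (((Finset.range N).filter fun n => x ∈ box d n).filter
          fun n => x + z ∉ box d n).card * influence c z := by
    rw [Finset.card_eq_sum_ones, Nat.cast_sum, Finset.sum_mul, Finset.sum_filter (fun n => x + z ∉ box d n)]
    refine Finset.sum_congr rfl fun n _ => ?_
    by_cases hx : x + z ∈ box d n <;> simp [hx]
  rw [h]
  gcongr
  refine le_trans (Nat.cast_le.2 ?_) (siteNorm_le_enorm z)
  refine (Finset.card_le_card (t := Finset.Ico (siteNorm x) (siteNorm x + siteNorm z))
    fun n hn => ?_).trans (by simp)
  simp only [Finset.mem_filter, mem_box] at hn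
  rw [Finset.mem_Ico]
  have := siteNorm_add_le x z
  omega

lemma outerInfluence_box_le (c : Rates d q) {x : Fin d → ℤ} {n : ℕ} (hx : x ∈ box d n) :
    outerInfluence c (box d n) x ≤ influenceMoment c :=
  (Finset.single_le_sum (f := fun n => outerInfluence c (box d n) x) (fun _ _ => zero_le)
    (Finset.mem_filter.2 ⟨Finset.mem_range.2 n.lt_succ_self, hx⟩)).trans
    (sum_outerInfluence_range_le c x (n + 1))

/-! ### The growth argument and the divergence of the harmonic series. -/

/-- Dividing by `V N * V (N+1) ≤ V (N+1)²` gives `b / (2 N + 1) ≤ 1 / V N - 1 / V (N+1)`. The right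
side telescopes to a bounded sum, whereas the left side diverges. -/
lemma not_pos_of_sq_le_mul_sub {V : ℕ → ℝ} {b : ℝ} (hb : 0 < b) (hV : Monotone V)
    (h : ∀ N, b * V (N + 1) ^ 2 ≤ (2 * N + 1) * (V (N + 1) - V N)) (k : ℕ) : ¬ 0 < V k := by
  intro hk
  have hpos : ∀ N, 0 < V (N + k) := fun N => hk.trans_le (hV (by omega))
  have hstep : ∀ N, b / (2 * (N + k : ℕ) + 1) ≤ 1 / V (N + k) - 1 / V (N + 1 + k) := fun N => by
    have h1 := h (N + k)
    have h0 := hpos N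
    have h2 : 0 < V (N + k + 1) := by have := hpos (N + 1); rwa [add_right_comm] at this
    have h3 : V (N + k) ≤ V (N + k + 1) := hV (by omega)
    rw [add_right_comm N 1 k, div_sub_div _ _ h0.ne' h2.ne',
      div_le_div_iff₀ (by positivity) (mul_pos h0 h2)]
    have h4 : b * (V (N + k) * V (N + k + 1)) ≤ b * V (N + k + 1) ^ 2 := by
      rw [sq]; gcongr
    linarith
  have hsum : ∀ N, ∑ j ∈ Finset.range N, b / (2 * (j + k : ℕ) + 1) ≤ 1 / V k := fun N => by
    have h1 : ∑ j ∈ Finset.range N, b / (2 * (j + k : ℕ) + 1) ≤ 1 / V (0 + k) - 1 / V (N + k) := by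
      rw [← Finset.sum_range_sub' (fun j => 1 / V (j + k)) N]
      exact Finset.sum_le_sum fun j _ => hstep j
    have h2 := one_div_pos.2 (hpos N)
    rw [zero_add] at h1
    linarith
  have hs : Summable fun j : ℕ => b / (2 * (j + k : ℕ) + 1 : ℝ) :=
    summable_of_sum_range_le (fun j => by positivity) hsum
  have hs2 : Summable fun j : ℕ => b / (2 * j + 1 : ℝ) :=
    (summable_nat_add_iff (f := fun j : ℕ => b / (2 * j + 1 : ℝ)) k).1 hs
  have hs3 : Summable fun j : ℕ => 1 / ((j + 1 : ℕ) : ℝ) := by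
    refine Summable.of_nonneg_of_le (fun j => by positivity) (fun j => ?_) (hs2.mul_left (2 / b))
    have e : 2 / b * (b / (2 * j + 1 : ℝ)) = 2 / (2 * j + 1) := by field_simp
    rw [e, div_le_div_iff₀ (by positivity) (by positivity)]
    push_cast
    linarith
  exact Real.not_summable_one_div_natCast ((summable_nat_add_iff 1).1 hs3)

/-- The growth argument in low dimensions. -/
lemma eq_zero_of_sum_le_sum_mul_sqrt {ι : Type*} [DecidableEq ι] {B : ℕ → Finset ι}
    (hB : Monotone B) {e a : ℕ → ι → ℝ}
    (he : ∀ n x, x ∈ B n → 0 ≤ e n x) (ha : ∀ n x, x ∈ B n → 0 ≤ a n x)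
    (hmono : ∀ m n x, m ≤ n → x ∈ B m → e m x ≤ e n x) {κ C A M : ℝ} (hκ : 0 < κ)
    (hA : ∀ n : ℕ, ∑ x ∈ B n, a n x ≤ A * (2 * n + 1))
    (hM : ∀ N x, ∑ n ∈ Finset.range N with x ∈ B n, a n x ≤ M)
    (h : ∀ n, κ * ∑ x ∈ B n, e n x ≤ C * ∑ x ∈ B n, a n x * √(e n x)) :
    ∀ n x, x ∈ B n → e n x = 0 := by
  set S : ℕ → ℝ := fun n => ∑ x ∈ B n, e n x with hS
  set u : ℕ → ℝ := fun n => ∑ x ∈ B n, a n x * e n x with hu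
  set V : ℕ → ℝ := fun N => ∑ n ∈ Finset.range N, u n with hVdef
  have hS0 : ∀ n, 0 ≤ S n := fun n => Finset.sum_nonneg fun x hx => he n x hx
  have hu0 : ∀ n, 0 ≤ u n := fun n =>
    Finset.sum_nonneg fun x hx => mul_nonneg (ha n x hx) (he n x hx)
  have hV0 : ∀ N, 0 ≤ V N := fun N => Finset.sum_nonneg fun n _ => hu0 n
  have hVs : ∀ N, V (N + 1) - V N = u N := fun N => by
    simp [hVdef, Finset.sum_range_succ]
  have hVmono : Monotone V := monotone_nat_of_le_succ fun N => by
    have := hVs N; have := hu0 N; linarith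
  have hsq : ∀ n, (κ * S n) ^ 2 ≤ C ^ 2 * (A * (2 * n + 1) * u n) := fun n => by
    have h1 : (∑ x ∈ B n, a n x * √(e n x)) ^ 2 ≤ (∑ x ∈ B n, a n x) * u n := by
      refine Finset.sum_sq_le_sum_mul_sum_of_sq_le_mul _ (fun x hx => ha n x hx)
        (fun x hx => mul_nonneg (ha n x hx) (he n x hx)) fun x hx => ?_
      rw [mul_pow, Real.sq_sqrt (he n x hx), sq, mul_assoc]
    calc (κ * S n) ^ 2 ≤ (C * ∑ x ∈ B n, a n x * √(e n x)) ^ 2 :=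
          pow_le_pow_left₀ (mul_nonneg hκ.le (hS0 n)) (h n) 2
      _ = C ^ 2 * (∑ x ∈ B n, a n x * √(e n x)) ^ 2 := mul_pow _ _ _
      _ ≤ C ^ 2 * (A * (2 * n + 1) * u n) := by
          gcongr
          exact h1.trans (mul_le_mul_of_nonneg_right (hA n) (hu0 n))
  -- By monotonicity every `e n x` with `n ≤ N` is replaced by `e N x`; after exchanging the sums,
  -- the total of `a n x` over scales is at most `M`.
  have hVS : ∀ N, V (N + 1) ≤ M * S N := fun N => by
    calc V (N + 1) ≤ ∑ n ∈ Finset.range (N + 1), ∑ x ∈ B N,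
            if x ∈ B n then a n x * e N x else 0 := by
          refine Finset.sum_le_sum fun n hn => ?_
          have hn' : n ≤ N := Nat.lt_succ_iff.1 (Finset.mem_range.1 hn)
          rw [← Finset.sum_filter, Finset.filter_mem_eq_inter,
            Finset.inter_eq_right.2 (hB hn')]
          exact Finset.sum_le_sum fun x hx =>
            mul_le_mul_of_nonneg_left (hmono n N x hn' hx) (ha n x hx)
      _ = ∑ x ∈ B N, (∑ n ∈ Finset.range (N + 1) with x ∈ B n, a n x) * e N x := by
          rw [Finset.sum_comm]
          refine Finset.sum_congr rfl fun x _ => ?_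
          rw [Finset.sum_mul, Finset.sum_filter]
      _ ≤ ∑ x ∈ B N, M * e N x := Finset.sum_le_sum fun x hx =>
          mul_le_mul_of_nonneg_right (hM _ x) (he N x hx)
      _ = M * S N := (Finset.mul_sum _ _ _).symm
  have hVz : ∀ N, V N = 0 := by
    by_contra! hne
    obtain ⟨k, hk⟩ := hne
    have hk' : 0 < V k := lt_of_le_of_ne (hV0 k) hk.symm
    -- The summand `1` only keeps the constant positive, since `M`, `C` or `A` may vanish.
    have hkey : ∀ N, κ ^ 2 * V (N + 1) ^ 2
        ≤ (M ^ 2 * C ^ 2 * A + 1) * ((2 * N + 1) * (V (N + 1) - V N)) := fun N => by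
      have h1 : V (N + 1) ^ 2 ≤ M ^ 2 * S N ^ 2 := by
        rw [← mul_pow]; exact pow_le_pow_left₀ (hV0 _) (hVS N) 2
      have h2 := mul_le_mul_of_nonneg_left (hsq N) (sq_nonneg M)
      have h3 := mul_le_mul_of_nonneg_left h1 (sq_nonneg κ)
      have h4 : 0 ≤ (2 * N + 1) * u N := mul_nonneg (by positivity) (hu0 N)
      rw [hVs]
      nlinarith
    have hA0 : 0 ≤ A := by
      have := (Finset.sum_nonneg fun x hx => ha 0 x hx).trans (hA 0)
      simpa using this
    have hD : 0 < M ^ 2 * C ^ 2 * A + 1 := by positivity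
    refine not_pos_of_sq_le_mul_sub (b := κ ^ 2 / (M ^ 2 * C ^ 2 * A + 1)) (by positivity) hVmono
      (fun N => ?_) k hk'
    rw [div_mul_eq_mul_div, div_le_iff₀ hD, mul_comm _ (M ^ 2 * C ^ 2 * A + 1)]
    exact hkey N
  intro n x hx
  have hun : u n = 0 := by rw [← hVs, hVz, hVz, sub_zero]
  have hSn : S n = 0 := by
    have h1 := hsq n
    rw [hun, mul_zero, mul_zero] at h1
    have h2 : κ * S n = 0 := pow_eq_zero_iff (two_ne_zero) |>.1 (le_antisymm h1 (sq_nonneg _))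
    exact (mul_eq_zero.1 h2).resolve_left hκ.ne'
  exact (Finset.sum_eq_zero_iff_of_nonneg fun x hx => he n x hx).1 hSn x hx

/-! ### Entropy balance over one period. -/

lemma integral_sqrt_le {g : ℝ → ℝ} (hg : Continuous g) (hg0 : ∀ t, 0 ≤ g t) {T : ℝ} (hT : 0 < T) :
    ∫ t in 0..T, √(g t) ≤ √T * √(∫ t in 0..T, g t) := by
  set I := ∫ t in 0..T, √(g t) with hI
  have hint : IntervalIntegrable g volume 0 T := hg.intervalIntegrable _ _
  have hints : IntervalIntegrable (fun t => √(g t)) volume 0 T :=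
    (Real.continuous_sqrt.comp hg).intervalIntegrable _ _
  -- Cauchy–Schwarz in the form of a nonnegative variance of `√g` about its mean `I / T`.
  have h0 : 0 ≤ ∫ t in 0..T, (√(g t) - I / T) ^ 2 :=
    intervalIntegral.integral_nonneg hT.le fun t _ => sq_nonneg _
  have e : ∫ t in 0..T, (√(g t) - I / T) ^ 2 = (∫ t in 0..T, g t) - I ^ 2 / T := by
    have : ∀ t, (√(g t) - I / T) ^ 2 = g t - 2 * (I / T) * √(g t) + (I / T) ^ 2 := fun t => by
      rw [sub_sq, Real.sq_sqrt (hg0 t)]; ring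
    simp_rw [this]
    rw [intervalIntegral.integral_add (hint.sub (hints.const_mul _)) (by simp),
      intervalIntegral.integral_sub hint (hints.const_mul _),
      intervalIntegral.integral_const_mul, intervalIntegral.integral_const, ← hI]
    simp only [sub_zero, smul_eq_mul]
    field_simp
    ring
  rw [e, sub_nonneg, div_le_iff₀ hT, mul_comm] at h0
  rw [← Real.sqrt_mul hT.le]
  exact Real.le_sqrt_of_sq_le h0

lemma cyl_evolve_eq_mean (P : MarkovSemigroup (Config d q)) (ν : ProbabilityMeasure (Config d q))
    (Λ : Finset (Fin d → ℤ)) (σ : Λ → Fin q) :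
    (fun t : ℝ => cyl (P.evolve ν t.toNNReal : Measure (Config d q)) Λ σ)
      = P.mean ν (localFun Λ (Pi.single σ 1)) := by
  funext t
  exact cyl_eq_integral Λ σ _

lemma continuous_cyl_evolve (P : MarkovSemigroup (Config d q))
    (ν : ProbabilityMeasure (Config d q)) (Λ : Finset (Fin d → ℤ)) (σ : Λ → Fin q) :
    Continuous fun t : ℝ => cyl (P.evolve ν t.toNNReal : Measure (Config d q)) Λ σ := by
  rw [cyl_evolve_eq_mean]
  exact P.continuous_mean ν _

lemma continuous_hellinger_evolve (r : (Fin d → ℤ) → Fin q → ℝ) (P : MarkovSemigroup (Config d q))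
    (ν : ProbabilityMeasure (Config d q)) (Λ : Finset (Fin d → ℤ)) (x : Λ) :
    Continuous fun t : ℝ =>
      hellinger r Λ (cyl (P.evolve ν t.toNNReal : Measure (Config d q)) Λ) x := by
  unfold hellinger
  refine continuous_finsetSum _ fun i _ => continuous_finsetSum _ fun σ _ => ?_
  exact ((Real.continuous_sqrt.comp (continuous_cyl_evolve P ν Λ σ)).sub
    (Real.continuous_sqrt.comp (continuous_const.mul (continuous_cyl_evolve P ν Λ _)))).pow 2

lemma hasDerivAt_mul_log_div {m u : ℝ} (hm : 0 < m) (hu : 0 < u) :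
    HasDerivAt (fun u => u * Real.log (u / m)) (Real.log (u / m) + 1) u := by
  have h := (hasDerivAt_id u).mul (((hasDerivAt_id u).div_const m).log (div_pos hu hm).ne')
  refine h.congr_deriv ?_
  simp only [id]
  field_simp

/-- The entropy inequality integrated over a period. -/
lemma integral_hellinger_le {c : Rates d q} (hc : ∀ x i, Continuous (c x i)) {κ : ℝ}
    (hκ : 0 ≤ κ) (hcκ : ∀ x i η, κ ≤ c x i η) {P : MarkovSemigroup (Config d q)}
    (hP : IsGeneratedBy P c) {r : (Fin d → ℤ) → Fin q → ℝ} {ε : ℝ} (hε : 0 < ε)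
    (hr : ∀ x i, ε ≤ r x i) (hr1 : ∀ x i, r x i ≤ 1) (ν μ : ProbabilityMeasure (Config d q))
    (hst : P.IsStationary μ) (Λ : Finset (Fin d → ℤ))
    (hμ : ∀ σ, cyl (μ : Measure (Config d q)) Λ σ = ∏ y : Λ, r y (σ y))
    (hν : ∀ t σ, 0 < cyl (P.evolve ν t : Measure (Config d q)) Λ σ) {T : ℝ≥0} (hT : 0 < T)
    (hper : P.evolve ν T = ν) {a : Λ → ℝ} (ha0 : ∀ x, 0 ≤ a x)
    (ha : ∀ (x : Λ) (i : Fin q) (η ξ : Config d q), Λ.restrict η = Λ.restrict ξ → η x ≠ i →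
      |c x i η - c x i ξ| ≤ a x) :
    κ * ∑ x, ∫ t in 0..(T : ℝ),
        hellinger r Λ (cyl (P.evolve ν t.toNNReal : Measure (Config d q)) Λ) x
      ≤ √(2 * (q + q / ε)) * √T * ∑ x, a x * √(∫ t in 0..(T : ℝ),
        hellinger r Λ (cyl (P.evolve ν t.toNNReal : Measure (Config d q)) Λ) x) := by
  classical
  have hT' : (0 : ℝ) < T := hT
  have hm : ∀ σ, 0 < cyl (μ : Measure (Config d q)) Λ σ := fun σ => by
    rw [hμ]; exact Finset.prod_pos fun y _ => hε.trans_le (hr _ _)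
  set p : ℝ → (Λ → Fin q) → ℝ := fun t => cyl (P.evolve ν t.toNNReal : Measure (Config d q)) Λ
    with hp
  set m := cyl (μ : Measure (Config d q)) Λ with hmdef
  set D : Λ → ℝ → ℝ := fun x t => hellinger r Λ (p t) x with hD
  have hpc : ∀ σ, Continuous fun t => p t σ := continuous_cyl_evolve P ν Λ
  have hDc : ∀ x, Continuous (D x) := continuous_hellinger_evolve r P ν Λ
  have hD0 : ∀ x t, 0 ≤ D x t := fun x t => hellinger_nonneg _ _ _ _
  set H : ℝ → ℝ := fun t => ∑ σ, p t σ * Real.log (p t σ / m σ) with hH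
  set H' : ℝ → ℝ := fun t => ∑ σ, P.mean ν (localGen c hc Λ (Pi.single σ 1)) t *
    (Real.log (p t σ / m σ) + 1) with hH'
  have hlogc : ∀ σ, Continuous fun t => Real.log (p t σ / m σ) := fun σ =>
    ((hpc σ).div_const _).log fun t => (div_pos (hν _ σ) (hm σ)).ne'
  have hHc : Continuous H := continuous_finsetSum _ fun σ _ => (hpc σ).mul (hlogc σ)
  have hH'c : Continuous H' := continuous_finsetSum _ fun σ _ =>
    (P.continuous_mean ν _).mul ((hlogc σ).add continuous_const)
  have hderiv : ∀ t ∈ Set.Ioo 0 (T : ℝ), HasDerivWithinAt H (H' t) (Set.Ioi t) t := fun t ht => by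
    refine HasDerivWithinAt.fun_sum fun σ _ => ?_
    have h1 := P.hasDerivWithinAt_mean ν (localFun_mem_generatorGraph hP hc Λ (Pi.single σ 1))
      ht.1.le
    rw [← cyl_evolve_eq_mean] at h1
    have h2 := (hasDerivAt_mul_log_div (hm σ) (hν t.toNNReal σ)).comp_hasDerivWithinAt t h1
    rw [mul_comm] at h2
    exact h2
  have hftc := intervalIntegral.integral_eq_sub_of_hasDeriv_right_of_le hT'.le hHc.continuousOn
    hderiv (hH'c.intervalIntegrable _ _)
  have hend : H T = H 0 := by
    simp only [hH, hp, Real.toNNReal_coe, Real.toNNReal_zero, hper, P.evolve_zero]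
  rw [hend, sub_self] at hftc
  have hbound : ∀ t, H' t ≤ -κ * ∑ x, D x t + √(2 * (q + q / ε)) * ∑ x, a x * √(D x t) :=
    fun t => by
    have h1 := integral_localGen_log_le hc hκ hcκ hε hr hr1
      (P.evolve ν t.toNNReal : Measure (Config d q)) (μ : Measure (Config d q)) Λ hμ (hν _)
      (fun G => hst.integral_generator_eq_zero (localFun_mem_generatorGraph hP hc Λ G)) ha0 ha
    -- The chain rule produces a sum over `σ`; by linearity it is the generator applied to `log (p /
    -- m) + 1` with that function frozen at time `t`.
    rw [integral_localGen_eq_sum] at h1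
    exact h1
  have hI1 : ∀ x, IntervalIntegrable (D x) volume 0 T := fun x => (hDc x).intervalIntegrable _ _
  have hI2 : ∀ x, IntervalIntegrable (fun t => √(D x t)) volume 0 T := fun x =>
    (Real.continuous_sqrt.comp (hDc x)).intervalIntegrable _ _
  have hJ1 : IntervalIntegrable (fun t => -κ * ∑ x, D x t) volume 0 T :=
    (continuous_const.mul (continuous_finsetSum _ fun x _ => hDc x)).intervalIntegrable _ _
  have hJ2 : IntervalIntegrable (fun t => √(2 * (q + q / ε)) * ∑ x, a x * √(D x t)) volume 0 T :=
    (continuous_const.mul (continuous_finsetSum _ fun x _ => continuous_const.mul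
      (Real.continuous_sqrt.comp (hDc x)))).intervalIntegrable _ _
  have hmono := intervalIntegral.integral_mono_on hT'.le (hH'c.intervalIntegrable _ _)
    (hJ1.add hJ2) fun t _ => hbound t
  rw [hftc, intervalIntegral.integral_add hJ1 hJ2, intervalIntegral.integral_const_mul,
    intervalIntegral.integral_const_mul, intervalIntegral.integral_finsetSum fun x _ => hI1 x,
    intervalIntegral.integral_finsetSum fun x _ => (hI2 x).const_mul _] at hmono
  simp only [intervalIntegral.integral_const_mul] at hmono
  have hcs : ∑ x, a x * ∫ t in 0..(T : ℝ), √(D x t)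
      ≤ √T * ∑ x, a x * √(∫ t in 0..(T : ℝ), D x t) := by
    rw [Finset.mul_sum]
    refine Finset.sum_le_sum fun x _ => ?_
    rw [mul_left_comm]
    exact mul_le_mul_of_nonneg_left (integral_sqrt_le (hDc x) (hD0 x) hT') (ha0 x)
  have h := mul_le_mul_of_nonneg_left hcs (Real.sqrt_nonneg (2 * (q + q / ε)))
  rw [← mul_assoc] at h
  linarith

/-! ### Identification of the measure from a vanishing Hellinger form. -/

lemma eq_of_update_eq {ι α β : Type*} [Fintype ι] [DecidableEq ι] {f : (ι → α) → β}
    (h : ∀ σ x i, f (Function.update σ x i) = f σ) (σ τ : ι → α) : f σ = f τ := by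
  have key : ∀ s : Finset ι, f (s.piecewise τ σ) = f σ := fun s => by
    induction s using Finset.induction_on with
    | empty => simp
    | insert y s _ ih => rw [Finset.piecewise_insert, h, ih]
  rw [← key Finset.univ, Finset.piecewise_univ]

lemma eq_prod_of_hellinger_eq_zero {r : (Fin d → ℤ) → Fin q → ℝ} (hr : ∀ x i, 0 < r x i)
    (Λ : Finset (Fin d → ℤ)) {p : (Λ → Fin q) → ℝ} (hp : ∀ σ, 0 ≤ p σ) (hp1 : ∑ σ, p σ = 1)
    (hr1 : ∑ σ : Λ → Fin q, ∏ y : Λ, r y (σ y) = 1)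
    (h : ∀ x, hellinger r Λ p x = 0) (σ : Λ → Fin q) : p σ = ∏ y : Λ, r y (σ y) := by
  classical
  have hm : ∀ σ : Λ → Fin q, 0 < ∏ y : Λ, r y (σ y) := fun σ => Finset.prod_pos fun y _ => hr _ _
  -- A zero sum of squares makes the density `p / ∏ r` invariant under every single-spin change,
  -- hence constant; normalisation then makes it `1`.
  have hconst : ∀ σ (x : Λ) i, p (Function.update σ x i) /
      (∏ y : Λ, r y (Function.update σ x i y)) = p σ / ∏ y : Λ, r y (σ y) := fun σ x i => by
    have h1 := (Finset.sum_eq_zero_iff_of_nonneg fun _ _ => Finset.sum_nonneg fun _ _ =>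
      sq_nonneg _).1 (h x) i (Finset.mem_univ i)
    have h2 := (Finset.sum_eq_zero_iff_of_nonneg fun _ _ => sq_nonneg _).1 h1 σ (Finset.mem_univ σ)
    have h3 := sub_eq_zero.1 ((pow_eq_zero_iff two_ne_zero).1 h2)
    rw [Real.sqrt_inj (hp _) (mul_nonneg (div_nonneg (hr _ _).le (hr _ _).le) (hp _)),
      ← prod_update_div hr Λ σ x i] at h3
    rw [h3]
    have := (hm σ).ne'
    field_simp
  have hall : ∀ τ, p σ * ∏ y : Λ, r y (τ y) = p τ * ∏ y : Λ, r y (σ y) := fun τ => by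
    have := eq_of_update_eq (f := fun σ : Λ → Fin q => p σ / ∏ y : Λ, r y (σ y)) hconst σ τ
    exact (div_eq_div_iff (hm σ).ne' (hm τ).ne').1 this
  have hsum := Finset.sum_congr (rfl : (Finset.univ : Finset (Λ → Fin q)) = Finset.univ)
    fun τ _ => hall τ
  rwa [← Finset.mul_sum, ← Finset.sum_mul, hp1, hr1, mul_one, one_mul] at hsum

/-- Boxes exhaust the finite sets of sites, so all finite-dimensional marginals agree, and a
projective limit is unique. -/
lemma ext_of_cyl_box {ν μ : Measure (Config d q)} [IsProbabilityMeasure ν]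
    [IsProbabilityMeasure μ] (h : ∀ n σ, cyl ν (box d n) σ = cyl μ (box d n) σ) : ν = μ := by
  have hall : ∀ Λ σ, cyl ν Λ σ = cyl μ Λ σ := fun Λ σ => by
    obtain ⟨n, hn⟩ := exists_subset_box Λ
    rw [cyl_eq_sum ν hn, cyl_eq_sum μ hn]
    exact Finset.sum_congr rfl fun τ _ => h n τ
  have hmap : ∀ Λ : Finset (Fin d → ℤ), ν.map Λ.restrict = μ.map Λ.restrict := fun Λ => by
    refine Measure.ext_of_singleton fun σ => ?_
    rw [Measure.map_apply Λ.measurable_restrict (measurableSet_singleton σ),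
      Measure.map_apply Λ.measurable_restrict (measurableSet_singleton σ)]
    exact (ENNReal.toReal_eq_toReal_iff' (measure_ne_top _ _) (measure_ne_top _ _)).1 (hall Λ σ)
  have : ∀ Λ : Finset (Fin d → ℤ), IsFiniteMeasure (μ.map Λ.restrict) := fun Λ => inferInstance
  exact IsProjectiveLimit.unique (P := fun Λ => μ.map Λ.restrict) hmap fun Λ => rfl

/-- A periodic orbit of measures that charge all cylinders starts at the stationary product
measure. -/
lemma eq_of_evolve_eq_self (hd : d = 1 ∨ d = 2) {c : Rates d q} (hc : c.Regular)
    {P : MarkovSemigroup (Config d q)} (hP : IsGeneratedBy P c)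
    {μ : ProbabilityMeasure (Config d q)} {r : (Fin d → ℤ) → Fin q → ℝ} {ε : ℝ} (hε : 0 < ε)
    (hr : ∀ x i, ε ≤ r x i) (hr1 : ∀ x i, r x i ≤ 1)
    (hμr : ∀ Λ σ, cyl (μ : Measure (Config d q)) Λ σ = ∏ y : Λ, r y (σ y))
    (hμ : P.IsStationary μ) {ν : ProbabilityMeasure (Config d q)} {T : ℝ≥0} (hT : 0 < T)
    (hper : P.evolve ν T = ν)
    (hν : ∀ t Λ σ, 0 < cyl (P.evolve ν t : Measure (Config d q)) Λ σ) : ν = μ := by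
  classical
  obtain ⟨κ, hκ, hcκ⟩ := hc.pos
  have hT' : (0 : ℝ) < T := hT
  have hr0 : ∀ x i, 0 < r x i := fun x i => hε.trans_le (hr x i)
  have hM : influenceMoment c ≠ ⊤ := hc.shortRange.ne
  set p : ∀ n : ℕ, ℝ → (box d n → Fin q) → ℝ :=
    fun n t => cyl (P.evolve ν t.toNNReal : Measure (Config d q)) (box d n) with hp
  -- The default `0` outside the box is never used: the growth argument reads `e n x` only for `x ∈
  -- box d n`.
  set e : ℕ → (Fin d → ℤ) → ℝ := fun n x => if hx : x ∈ box d n then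
    ∫ t in 0..(T : ℝ), hellinger r (box d n) (p n t) ⟨x, hx⟩ else 0 with he
  have he' : ∀ n (x : box d n), e n x = ∫ t in 0..(T : ℝ), hellinger r (box d n) (p n t) x :=
    fun n x => by simp [he]
  set a : ℕ → (Fin d → ℤ) → ℝ := fun n x => (outerInfluence c (box d n) x).toReal with ha
  have hfin : ∀ n x, x ∈ box d n → outerInfluence c (box d n) x ≠ ⊤ := fun n x hx =>
    ((outerInfluence_box_le c hx).trans_lt hM.lt_top).ne
  have hzero := eq_zero_of_sum_le_sum_mul_sqrt (B := box d) (e := e) (a := a) (κ := κ)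
    (C := √(2 * (q + q / ε)) * √T) (A := d * (influenceMoment c).toReal)
    (M := (influenceMoment c).toReal) (fun m n h => box_mono h) ?_ ?_ ?_ hκ ?_ ?_ ?_
  · have hcyl : ∀ n σ, cyl (ν : Measure (Config d q)) (box d n) σ
        = cyl (μ : Measure (Config d q)) (box d n) σ := fun n σ => by
      rw [hμr]
      refine eq_prod_of_hellinger_eq_zero hr0 _ (cyl_nonneg _ _) (sum_cyl _ _) ?_ (fun x => ?_) σ
      · rw [← sum_cyl (box d n) (μ : Measure (Config d q))]
        exact Finset.sum_congr rfl fun σ _ => (hμr _ σ).symm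
      · have h0 := hzero n x x.2
        rw [he'] at h0
        by_contra hne
        -- A continuous nonnegative integrand that is positive at time `0` has positive integral, so
        -- the zero integral gives information about `ν` itself.
        have hpos : 0 < ∫ t in 0..(T : ℝ), hellinger r (box d n) (p n t) x := by
          refine intervalIntegral.integral_pos hT'
            (continuous_hellinger_evolve r P ν (box d n) x).continuousOn
            (fun t _ => hellinger_nonneg _ _ _ _) ⟨0, ⟨le_rfl, hT'.le⟩, ?_⟩
          simp only [hp, Real.toNNReal_zero, P.evolve_zero]
          exact lt_of_le_of_ne (hellinger_nonneg _ _ _ _) (Ne.symm hne)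
        exact hpos.ne' h0
    have heq : (ν : Measure (Config d q)) = μ := ext_of_cyl_box hcyl
    exact Subtype.ext heq
  · intro n x hx
    rw [he' n ⟨x, hx⟩]
    exact intervalIntegral.integral_nonneg hT'.le fun t _ => hellinger_nonneg _ _ _ _
  · exact fun n x _ => ENNReal.toReal_nonneg
  · intro m n x hmn hx
    rw [he' m ⟨x, hx⟩, he' n ⟨x, box_mono hmn hx⟩]
    refine intervalIntegral.integral_mono_on hT'.le
      ((continuous_hellinger_evolve r P ν _ _).intervalIntegrable _ _)
      ((continuous_hellinger_evolve r P ν _ _).intervalIntegrable _ _) fun t _ => ?_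
    exact hellinger_mono hr0 (box_mono hmn) (cyl_nonneg _ _) (cyl_eq_sum _ (box_mono hmn)) ⟨x, hx⟩
  · intro n
    have h1 := ENNReal.toReal_mono (ENNReal.mul_ne_top (ENNReal.natCast_ne_top _) hM)
      (sum_outerInfluence_box_le c n)
    rw [ENNReal.toReal_sum (fun x hx => hfin n x hx), ENNReal.toReal_mul,
      ENNReal.toReal_natCast] at h1
    refine h1.trans ?_
    -- The dimension enters here: the surface of the box grows at most linearly in `n`.
    have h2 : d * (2 * n + 1) ^ (d - 1) ≤ d * (2 * n + 1) := by
      rcases hd with rfl | rfl <;> simp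
    have h3 : ((d * (2 * n + 1) ^ (d - 1) : ℕ) : ℝ) ≤ d * (2 * n + 1) := by exact_mod_cast h2
    calc _ ≤ (d * (2 * n + 1) : ℝ) * (influenceMoment c).toReal :=
          mul_le_mul_of_nonneg_right h3 ENNReal.toReal_nonneg
      _ = _ := by ring
  · intro N x
    have h1 := ENNReal.toReal_mono hM (sum_outerInfluence_range_le c x N)
    rwa [ENNReal.toReal_sum fun n hn => hfin n x (Finset.mem_filter.1 hn).2] at h1
  · intro n
    have h := integral_hellinger_le (a := fun x => a n x) hc.continuous hκ.le hcκ hP hε hr hr1 ν μ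
      hμ (box d n) (hμr _) (fun t => hν t _) hT hper (fun _ => ENNReal.toReal_nonneg)
      fun x i η ξ hηξ hi => by
        have h1 := edist_rate_le_outerInfluence hc.continuous (box d n) x i hηξ hi
        have h2 := ENNReal.toReal_mono (hfin n x x.2) h1
        rwa [edist_dist, ENNReal.toReal_ofReal dist_nonneg, Real.dist_eq] at h2
    rw [← Finset.sum_coe_sort, ← Finset.sum_coe_sort (box d n) fun x => a n x * √(e n x)]
    simp only [he']
    exact h

/-! ### Mixing with the stationary measure, and the conclusion. -/

/-- The equal mixture of two probability measures. -/
def mixture {X : Type*} [MeasurableSpace X] (ν μ : ProbabilityMeasure X) : ProbabilityMeasure X :=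
  ⟨(2⁻¹ : ℝ≥0∞) • (ν : Measure X) + (2⁻¹ : ℝ≥0∞) • (μ : Measure X),
    ⟨by simp [ENNReal.inv_two_add_inv_two]⟩⟩

lemma mixture_real {X : Type*} [MeasurableSpace X] (ν μ : ProbabilityMeasure X) (s : Set X) :
    (mixture ν μ : Measure X).real s
      = ((ν : Measure X).real s + (μ : Measure X).real s) / 2 := by
  simp only [mixture, ProbabilityMeasure.coe_mk, measureReal_def, Measure.add_apply,
    Measure.smul_apply, smul_eq_mul]
  rw [ENNReal.toReal_add (by finiteness) (by finiteness), ENNReal.toReal_mul, ENNReal.toReal_mul,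
    ENNReal.toReal_inv, ENNReal.toReal_ofNat]
  ring

lemma evolve_mixture {X : Type*} [TopologicalSpace X] [MeasurableSpace X] (P : MarkovSemigroup X)
    (ν μ : ProbabilityMeasure X) (t : ℝ≥0) :
    P.evolve (mixture ν μ) t = mixture (P.evolve ν t) (P.evolve μ t) := by
  apply Subtype.ext
  simp only [MarkovSemigroup.evolve, mixture, ProbabilityMeasure.coe_mk]
  rw [Measure.comp_add, Measure.comp_smul, Measure.comp_smul]

lemma eq_of_mixture_eq {X : Type*} [MeasurableSpace X] {ν μ : ProbabilityMeasure X}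
    (h : mixture ν μ = μ) : ν = μ := by
  have heq : (ν : Measure X) = μ := Measure.ext fun s _ => by
    have h1 := mixture_real ν μ s
    rw [h] at h1
    simp only [measureReal_def] at h1
    exact (ENNReal.toReal_eq_toReal_iff' (measure_ne_top _ _) (measure_ne_top _ _)).1 (by linarith)
  exact Subtype.ext heq

end IPS

end

theorem corollary2 {d q : ℕ} (hd : d = 1 ∨ d = 2)
    (c : IPS.Rates d q) (hc : c.Regular)
    (P : IPS.MarkovSemigroup (IPS.Config d q)) (hP : IPS.IsGeneratedBy P c)
    (μ : ProbabilityMeasure (IPS.Config d q)) (hμprod : IPS.IsProductMeasure μ)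
    (hμ : P.IsStationary μ) :
    ¬ ∃ ν : ProbabilityMeasure (IPS.Config d q),
      (∃ s t : ℝ≥0, P.evolve ν s ≠ P.evolve ν t) ∧
      ∃ T : ℝ≥0, 0 < T ∧ ∀ t : ℝ≥0, P.evolve ν (t + T) = P.evolve ν t := by
  rintro ⟨ν, ⟨s, t, hst⟩, T, hT, hper⟩
  obtain ⟨ρ, hρ⟩ := hμprod
  obtain ⟨κ, hκ, hcκ⟩ := hc.pos
  obtain ⟨K, hK, hcK⟩ := hc.exists_le
  have hcyl := IPS.cyl_eq_prod hρ
  have hq : 0 < q := by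
    obtain ⟨η⟩ : Nonempty (IPS.Config d q) := (μ : Measure (IPS.Config d q)).nonempty_of_neZero
    exact (Nat.zero_le _).trans_lt (η 0).2
  have hqK : 0 < q * K := mul_pos (Nat.cast_pos.2 hq) hK
  have hr : ∀ x i, κ / (q * K) ≤ (ρ x : Measure (Fin q)).real {i} := fun x i => by
    have h := IPS.le_mul_cyl_singleton hc.continuous hcκ hcK (μ : Measure (IPS.Config d q))
      (fun Λ G => hμ.integral_generator_eq_zero
        (IPS.localFun_mem_generatorGraph hP hc.continuous Λ G)) x i
    rw [hcyl, Finset.univ_unique, Finset.prod_singleton] at h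
    rw [div_le_iff₀ hqK, mul_comm]
    exact h
  have hpos : ∀ Λ σ, 0 < IPS.cyl (μ : Measure (IPS.Config d q)) Λ σ := fun Λ σ => by
    rw [hcyl]
    exact Finset.prod_pos fun y _ => (div_pos hκ hqK).trans_le (hr _ _)
  have hν0 : P.evolve ν T = ν := by
    have h := hper 0
    rwa [zero_add, P.evolve_zero] at h
  -- The evolution is affine and fixes `μ`, so the mixture has the same period as `ν`; at every time
  -- it dominates `μ / 2` and therefore charges all cylinders.
  have hmix : IPS.mixture ν μ = μ := by
    refine IPS.eq_of_evolve_eq_self hd hc hP (div_pos hκ hqK) hr (fun _ _ => measureReal_le_one)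
      hcyl hμ hT ?_ fun t Λ σ => ?_
    · rw [IPS.evolve_mixture, hν0, hμ]
    · rw [IPS.evolve_mixture, hμ, IPS.cyl, IPS.mixture_real]
      have h1 : 0 < (μ : Measure (IPS.Config d q)).real (Λ.restrict ⁻¹' {σ}) := hpos Λ σ
      have h2 : 0 ≤ (P.evolve ν t : Measure (IPS.Config d q)).real (Λ.restrict ⁻¹' {σ}) :=
        measureReal_nonneg
      linarith
  obtain rfl := IPS.eq_of_mixture_eq hmix
  exact hst (by rw [hμ, hμ])
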